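/- \textbf{Proposition 3 (Complete orthonormal set).} Consider the eigenvalue problem \[ -\psi^{(6)}=\lambda^6\psi \ \text{ on } [-1,1],\qquad \psi'(\pm1)=\psi''(\pm1)=\psi^{(5)}(\pm1)=0 . \] Each of the two equations \[ \cos 2\lambda+\sqrt3\,\sin\lambda\,\sinh(\sqrt3\lambda)-\cos\lambda\,\cosh(\sqrt3\lambda)=0,\qquad \sin 2\lambda+\sqrt3\,\cos\lambda\,\sinh(\sqrt3\lambda)+\sin\lambda\,\cosh(\sqrt3\lambda)=0 \] has infinitely many positive roots, and they can be listed in increasing order; let $\lambda^c_1<\lambda^c_2<\cdots$ be all the positive roots of the first and $\lambda^s_1<\lambda^s_2<\cdots$ all those of the second. For $m\ge1$ put, with $\lambda=\lambda^c_m$, \[ \psi^c_m(x)=c^c_m\Big\{\tfrac{4\sin\lambda}{\cos\lambda-\cosh\sqrt3\lambda}\Big[-\cos\tfrac{\lambda}{2}\sinh\tfrac{\sqrt3\lambda}{2}\sin\tfrac{\lambda x}{2}\sinh\tfrac{\sqrt3\lambda x}{2}+\sin\tfrac{\lambda}{2}\cosh\tfrac{\sqrt3\lambda}{2}\cos\tfrac{\lambda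 x}{2}\cosh\tfrac{\sqrt3\lambda x}{2}\Big]+\cos\lambda x\Big\}, \] \[ c^c_m=2\sqrt{\lambda/d^c_m}\,\big[\cos\lambda-\cosh\sqrt3\lambda\big], \] \[ \begin{aligned} d^c_m={}&\sin4\lambda-6\lambda(\cos2\lambda-2)+2\lambda\cosh(2\sqrt3\lambda)+2\sin2\lambda\,\cosh^2\sqrt3\lambda\\ &+\cosh\sqrt3\lambda\,\big[\sin\lambda-3\sin3\lambda+4\lambda(\cos3\lambda-3\cos\lambda)\big]+4\sqrt3\,\sin^2\lambda\,\sinh\sqrt3\lambda\,(\cos\lambda-\cosh\sqrt3\lambda), \end{aligned} \] and, with $\lambda=\lambda^s_m$, \[ \psi^s_m(x)=c^s_m\Big\{\tfrac{4\cos\lambda}{\cos\lambda+\cosh\sqrt3\lambda}\Big[-\cos\tfrac{\lambda}{2}\cosh\tfrac{\sqrt3\lambda}{2}\sin\tfrac{\lambda x}{2}\cosh\tfrac{\sqrt3\lambda x}{2}+\sin\tfrac{\lambda}{2}\sinh\tfrac{\sqrt3\lambda}{2}\cos\tfrac{\lambda x}{2}\sinh\tfrac{\sqrt3\lambda x}{2}\Big]+\sin\lambda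 x\Big\}, \] \[ c^s_m=2\sqrt{\lambda/d^s_m}\,\big[\cos\lambda+\cosh\sqrt3\lambda\big], \] \[ \begin{aligned} d^s_m={}&12\lambda-3\sin2\lambda-\sin4\lambda+10\lambda\cos2\lambda-(\sin2\lambda-2\lambda)\cosh(2\sqrt3\lambda)\\ &-4\sqrt3\,\cos^2\lambda\,\sinh\sqrt3\lambda\,(\cos\lambda+\cosh\sqrt3\lambda)+2\cos\lambda\,\cosh\sqrt3\lambda\,\big(4\lambda(\cos2\lambda+2)-3\sin2\lambda\big). \end{aligned} \] Let $\psi^c_0=1$. Then $\psi^c_0$ is an eigenfunction of the problem with $\lambda=0$, each $\psi^c_m$ is an even eigenfunction with $\lambda=\lambda^c_m$, and each $\psi^s_m$ is an odd eigenfunction with $\lambda=\lambda^s_m$. The functions $\tfrac1{\sqrt2}\psi^c_0,\ \psi^c_m,\ \psi^s_m$ $(m\ge1)$ form a complete orthonormal set in the real Hilbert space $L^2[-1,1]$. Consequently every real $u\in L^2[-1,1]$ satisfies \[ u=\tfrac12u^c_0\,\psi^c_0+\sum_{m=1}^\infty\big(u^c_m\psi^c_m+u^s_m\psi^s_m\big),\qquad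 u^c_m=\int_{-1}^1u\,\psi^c_m\,dx\ (m\ge0),\quad u^s_m=\int_{-1}^1u\,\psi^s_m\,dx\ (m\ge1), \] with convergence of the partial sums over $m\le M$ to $u$ in $L^2[-1,1]$ as $M\to\infty$. -/

import Mathlib

open Real Set Filter Topology MeasureTheory

noncomputable section

namespace SixthOrderBeam

/-- Lebesgue measure on `[-1, 1]`. -/
abbrev intervalMeasure : Measure ℝ := volume.restrict (Icc (-1 : ℝ) 1)

/-- The real `L²[-1, 1]` pairing `∫_{-1}^{1} φ ψ`. -/
def pairing (φ ψ : ℝ → ℝ) : ℝ := ∫ x in (-1 : ℝ)..1, φ x * ψ x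

/-- The `k`-th derivative on the closed interval `[-1, 1]` (one-sided at the end points). -/
abbrev derivOn (k : ℕ) (ψ : ℝ → ℝ) (x : ℝ) : ℝ := iteratedDerivWithin k ψ (Icc (-1 : ℝ) 1) x

/-- `ψ` is an eigenfunction, with eigenvalue `l ^ 6`, of the problem `-ψ⁽⁶⁾ = l⁶ ψ` on `[-1, 1]`,
`ψ' = ψ'' = ψ⁽⁵⁾ = 0` at `x = ± 1`: a function of class `C⁶` on `[-1, 1]`, not identically zero
there, which satisfies the equation and the six boundary conditions. -/
structure IsEigenfunction (l : ℝ) (ψ : ℝ → ℝ) : Prop where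
  contDiffOn : ContDiffOn ℝ 6 ψ (Icc (-1 : ℝ) 1)
  nontrivial : ∃ x ∈ Icc (-1 : ℝ) 1, ψ x ≠ 0
  equation : ∀ x ∈ Icc (-1 : ℝ) 1, -derivOn 6 ψ x = l ^ 6 * ψ x
  boundary_one : derivOn 1 ψ (-1) = 0 ∧ derivOn 1 ψ 1 = 0
  boundary_two : derivOn 2 ψ (-1) = 0 ∧ derivOn 2 ψ 1 = 0
  boundary_five : derivOn 5 ψ (-1) = 0 ∧ derivOn 5 ψ 1 = 0

/-- Left-hand side of the even eigenvalue relation. -/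
def evenRelation (l : ℝ) : ℝ :=
  cos (2 * l) + √3 * sin l * sinh (√3 * l) - cos l * cosh (√3 * l)

/-- Left-hand side of the odd eigenvalue relation. -/
def oddRelation (l : ℝ) : ℝ :=
  sin (2 * l) + √3 * cos l * sinh (√3 * l) + sin l * cosh (√3 * l)

/-- `l 1 < l 2 < ...` is the increasing enumeration of all positive zeros of `F`. -/
def EnumeratesPositiveRoots (F : ℝ → ℝ) (l : ℕ+ → ℝ) : Prop :=
  StrictMono l ∧ range l = {x : ℝ | 0 < x ∧ F x = 0}

/-- The quantity `d^c` at the even root `l`. -/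
def evenD (l : ℝ) : ℝ :=
  sin (4 * l) - 6 * l * (cos (2 * l) - 2) + 2 * l * cosh (2 * √3 * l)
    + 2 * sin (2 * l) * cosh (√3 * l) ^ 2
    + cosh (√3 * l) * (sin l - 3 * sin (3 * l) + 4 * l * (cos (3 * l) - 3 * cos l))
    + 4 * √3 * sin l ^ 2 * sinh (√3 * l) * (cos l - cosh (√3 * l))

/-- The quantity `d^s` at the odd root `l`. -/
def oddD (l : ℝ) : ℝ :=
  12 * l - 3 * sin (2 * l) - sin (4 * l) + 10 * l * cos (2 * l)
    - (sin (2 * l) - 2 * l) * cosh (2 * √3 * l)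
    - 4 * √3 * cos l ^ 2 * sinh (√3 * l) * (cos l + cosh (√3 * l))
    + 2 * cos l * cosh (√3 * l) * (4 * l * (cos (2 * l) + 2) - 3 * sin (2 * l))

/-- The normalization constant `c^c` at the even root `l`. -/
def evenC (l : ℝ) : ℝ := 2 * √(l / evenD l) * (cos l - cosh (√3 * l))

/-- The normalization constant `c^s` at the odd root `l`. -/
def oddC (l : ℝ) : ℝ := 2 * √(l / oddD l) * (cos l + cosh (√3 * l))

/-- The even eigenfunction `ψ^c` attached to the even root `l`. -/
def evenPsi (l x : ℝ) : ℝ :=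
  evenC l *
    (4 * sin l / (cos l - cosh (√3 * l)) *
        (-(cos (l / 2) * sinh (√3 * l / 2) * sin (l / 2 * x) * sinh (√3 * l / 2 * x))
          + sin (l / 2) * cosh (√3 * l / 2) * cos (l / 2 * x) * cosh (√3 * l / 2 * x))
      + cos (l * x))

/-- The odd eigenfunction `ψ^s` attached to the odd root `l`. -/
def oddPsi (l x : ℝ) : ℝ :=
  oddC l *
    (4 * cos l / (cos l + cosh (√3 * l)) *
        (-(cos (l / 2) * cosh (√3 * l / 2) * sin (l / 2 * x) * cosh (√3 * l / 2 * x))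
          + sin (l / 2) * sinh (√3 * l / 2) * cos (l / 2 * x) * sinh (√3 * l / 2 * x))
      + sin (l * x))

/-- The constant eigenfunction `ψ₀^c = 1`. -/
def psiZero (_ : ℝ) : ℝ := 1

/-- Index set of the whole system: the constant, the even modes and the odd modes. -/
inductive Mode : Type
  | const : Mode
  | even (m : ℕ+) : Mode
  | odd (m : ℕ+) : Mode

/-- The system `ψ₀^c / √2`, `ψ_m^c`, `ψ_m^s` (`m ≥ 1`). The constant `ψ₀^c = 1` has norm `√2` in
`L²[-1, 1]`, whence the factor. -/
def mode (lc ls : ℕ+ → ℝ) : Mode → ℝ → ℝ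
  | Mode.const => fun x => psiZero x / √2
  | Mode.even m => evenPsi (lc m)
  | Mode.odd m => oddPsi (ls m)

/-- The partial sum up to `m = M` of the eigenfunction expansion of `u`. -/
def partialExpansion (lc ls : ℕ+ → ℝ) (u : ℝ → ℝ) (M : ℕ+) (x : ℝ) : ℝ :=
  1 / 2 * pairing u psiZero * psiZero x
    + ∑ m ∈ Finset.Icc 1 M,
        (pairing u (evenPsi (lc m)) * evenPsi (lc m) x
          + pairing u (oddPsi (ls m)) * oddPsi (ls m) x)

end SixthOrderBeam

end

open SixthOrderBeam

/-!
Integration by parts shows that `f ↦ -f⁽⁶⁾` with `f' = f'' = f⁽⁵⁾ = 0` at `±1` is symmetric and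
non-negative in `L²[-1, 1]`, with the constants as kernel. Its inverse on the functions of mean zero
is a compact symmetric operator, and completeness is the spectral theorem for that operator,
combined with the fact that its eigenfunctions are exactly the explicit ones.

*The inverse.* Let `A f (x) = ½ ∫_{-1}^x f - ½ ∫_x^1 f` (`skewPrim`). This operator is compact by
Arzelà–Ascoli (`isCompactOperator_kernelMap`) and skew-adjoint by Fubini (`skewPrim_skew`). With `P`
and `Q` the projections off the constants and off the affine functions, and `K = Q A³ P`, the
operator `K† K` (`solutionOp`) is compact, symmetric and non-negative; its kernel consists of the
constants (`solutionOp_eq_zero`). The primitive `A f` vanishes at `±1` precisely when `f` has mean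
zero, and this is how the projections produce the six boundary conditions. An eigenvector for
`μ ≠ 0` is, up to a null set, a sixfold primitive of a continuous function, so it is a classical
eigenfunction with `l⁶ = μ⁻¹` (`eigenvector_solutionOp`).

*The eigenfunctions.* By uniqueness for linear differential equations every solution of
`-f⁽⁶⁾ = l⁶ f` is a combination of `cos lx`, `sin lx` and the four products of `cos (lx/2)` or
`sin (lx/2)` with `cosh (√3 lx/2)` or `sinh (√3 lx/2)` (`exists_wave`). The even and the odd part of
an eigenfunction satisfy the boundary conditions separately. In either part the conditions on `f'`
and `f⁽⁵⁾` fix the three coefficients up to a common factor, because the remaining `2 × 2`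
determinant is a multiple of `cosh √3l ∓ cos l ≠ 0`; the condition on `f''` then becomes the
eigenvalue relation (`exists_eq_even_add_odd`). Up to a factor, `l > 0` thus has at most one even and one
odd eigenfunction, namely `evenPsi l` and `oddPsi l`.

*Orthonormality.* Orthogonality is Lagrange's identity together with parity. For the norms, pairing
an eigenfunction `f` with `x f'` gives
`6 l⁶ ∫ f² = l⁶ (f(1)² + f(-1)²) + f'''(1)² + f'''(-1)²` (`six_mul_pairing_self`), and at a root of
the relation `evenD l` and `oddD l` reduce to sums of squares proportional to these boundary terms
(`evenD_eq`, `oddD_eq`); this also shows that they are positive.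

*The roots.* At the zeros of `sin` the even relation reads `1 - cos l cosh √3l`, and at the zeros of
`cos` the odd one reads `sin l cosh √3l`; both alternate in sign, so there are infinitely many roots.
By analyticity each bounded interval contains finitely many of them, so they can be enumerated.
-/

namespace SixthOrderBeam

/-! ### Solutions of `-f⁽⁶⁾ = l⁶ f` -/

/-- Coordinates of a solution of `-f⁽⁶⁾ = l⁶ f` in the basis used by `wave`; `cc` stands for the
product of a cosine and a hyperbolic cosine, `ss`, `sc`, `cs` for the other three products. -/
@[ext]
structure Coeffs where
  c : ℝ
  s : ℝ
  cc : ℝ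
  ss : ℝ
  sc : ℝ
  cs : ℝ

/-- The general real solution of `-f⁽⁶⁾ = l⁶ f`; its even part carries the coefficients `c`, `cc`,
`ss` and its odd part `s`, `sc`, `cs`. -/
noncomputable def wave (l : ℝ) (a : Coeffs) (x : ℝ) : ℝ :=
  a.c * cos (l * x) + a.s * sin (l * x)
    + a.cc * (cos (l / 2 * x) * cosh (√3 * l / 2 * x))
    + a.ss * (sin (l / 2 * x) * sinh (√3 * l / 2 * x))
    + a.sc * (sin (l / 2 * x) * cosh (√3 * l / 2 * x))
    + a.cs * (cos (l / 2 * x) * sinh (√3 * l / 2 * x))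

/-- The action of `d/dx` on the coefficients of a `wave`. -/
noncomputable def Coeffs.deriv (l : ℝ) (a : Coeffs) : Coeffs where
  c := l * a.s
  s := -(l * a.c)
  cc := l / 2 * a.sc + √3 * l / 2 * a.cs
  ss := √3 * l / 2 * a.sc - l / 2 * a.cs
  sc := -(l / 2 * a.cc) + √3 * l / 2 * a.ss
  cs := √3 * l / 2 * a.cc + l / 2 * a.ss

/-- The `k`-th derivative of the solution with coefficients `a`. -/
noncomputable def waveJet (l : ℝ) (a : Coeffs) (k : ℕ) : ℝ → ℝ := wave l ((Coeffs.deriv l)^[k] a)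

lemma sqrt_three_sq : (√3 : ℝ) ^ 2 = 3 := Real.sq_sqrt (by norm_num)

lemma hasDerivAt_wave (l : ℝ) (a : Coeffs) (x : ℝ) :
    HasDerivAt (wave l a) (wave l (a.deriv l) x) x := by
  have h (k : ℝ) : HasDerivAt (fun y : ℝ => k * y) k x := by
    simpa using (hasDerivAt_id x).const_mul k
  have h1 := (h l).cos
  have h2 := (h l).sin
  have h3 := (h (l / 2)).cos
  have h4 := (h (l / 2)).sin
  have h5 := (h (√3 * l / 2)).cosh
  have h6 := (h (√3 * l / 2)).sinh
  have := (((((h1.const_mul a.c).add (h2.const_mul a.s)).add ((h3.mul h5).const_mul a.cc)).add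
    ((h4.mul h6).const_mul a.ss)).add ((h4.mul h5).const_mul a.sc)).add
    ((h3.mul h6).const_mul a.cs)
  refine this.congr_deriv ?_
  simp only [wave, Coeffs.deriv]
  ring

lemma hasDerivAt_waveJet (l : ℝ) (a : Coeffs) (k : ℕ) (x : ℝ) :
    HasDerivAt (waveJet l a k) (waveJet l a (k + 1) x) x := by
  rw [waveJet, waveJet, Function.iterate_succ_apply']
  exact hasDerivAt_wave _ _ _

lemma contDiff_wave (l : ℝ) (a : Coeffs) {n : WithTop ℕ∞} : ContDiff ℝ n (wave l a) := by
  unfold wave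
  have h1 (k : ℝ) : ContDiff ℝ n (fun x => cos (k * x)) := contDiff_cos.comp (by fun_prop)
  have h2 (k : ℝ) : ContDiff ℝ n (fun x => sin (k * x)) := contDiff_sin.comp (by fun_prop)
  have h3 (k : ℝ) : ContDiff ℝ n (fun x => cosh (k * x)) := contDiff_cosh.comp (by fun_prop)
  have h4 (k : ℝ) : ContDiff ℝ n (fun x => sinh (k * x)) := contDiff_sinh.comp (by fun_prop)
  fun_prop

lemma continuous_waveJet (l : ℝ) (a : Coeffs) (k : ℕ) : Continuous (waveJet l a k) :=
  (contDiff_wave l _ (n := 0)).continuous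

/-- Two differentiations rotate `(cc, ss)` by `-π/3` and `(sc, cs)` by `π/3`, up to the factor
`l ^ 2`. -/
lemma Coeffs.deriv_deriv (l : ℝ) (a : Coeffs) : (a.deriv l).deriv l =
    ⟨-(l ^ 2 * a.c), -(l ^ 2 * a.s), l ^ 2 * (a.cc / 2 + √3 / 2 * a.ss),
      l ^ 2 * (-(√3 / 2) * a.cc + a.ss / 2), l ^ 2 * (a.sc / 2 - √3 / 2 * a.cs),
      l ^ 2 * (√3 / 2 * a.sc + a.cs / 2)⟩ := by
  have h := sqrt_three_sq
  ext <;> simp only [Coeffs.deriv]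
  · ring
  · ring
  · linear_combination l ^ 2 * a.cc / 4 * h
  · linear_combination l ^ 2 * a.ss / 4 * h
  · linear_combination l ^ 2 * a.sc / 4 * h
  · linear_combination l ^ 2 * a.cs / 4 * h

lemma Coeffs.deriv_four (l : ℝ) (a : Coeffs) : (Coeffs.deriv l)^[4] a =
    ⟨l ^ 4 * a.c, l ^ 4 * a.s, l ^ 4 * (-(a.cc / 2) + √3 / 2 * a.ss),
      l ^ 4 * (-(√3 / 2) * a.cc - a.ss / 2), l ^ 4 * (-(a.sc / 2) - √3 / 2 * a.cs),
      l ^ 4 * (√3 / 2 * a.sc - a.cs / 2)⟩ := by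
  have h := sqrt_three_sq
  change (((a.deriv l).deriv l).deriv l).deriv l = _
  simp only [Coeffs.deriv_deriv]
  ext <;> simp only
  · ring
  · ring
  · linear_combination -l ^ 4 * a.cc / 4 * h
  · linear_combination -l ^ 4 * a.ss / 4 * h
  · linear_combination -l ^ 4 * a.sc / 4 * h
  · linear_combination -l ^ 4 * a.cs / 4 * h

lemma Coeffs.deriv_six (l : ℝ) (a : Coeffs) : (Coeffs.deriv l)^[6] a =
    ⟨-l ^ 6 * a.c, -l ^ 6 * a.s, -l ^ 6 * a.cc, -l ^ 6 * a.ss, -l ^ 6 * a.sc, -l ^ 6 * a.cs⟩ := by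
  have h := sqrt_three_sq
  rw [show (6 : ℕ) = 4 + 2 from rfl, Function.iterate_add_apply, Coeffs.deriv_four]
  change (⟨l ^ 4 * ((a.deriv l).deriv l).c, _, _, _, _, _⟩ : Coeffs) = _
  simp only [Function.iterate_succ, Function.iterate_zero, Function.comp, id, Coeffs.deriv_deriv]
  ext <;> simp only
  · ring
  · ring
  · linear_combination -l ^ 6 * a.cc / 4 * h
  · linear_combination -l ^ 6 * a.ss / 4 * h
  · linear_combination -l ^ 6 * a.sc / 4 * h
  · linear_combination -l ^ 6 * a.cs / 4 * h

lemma waveJet_six_add (l : ℝ) (a : Coeffs) (k : ℕ) (x : ℝ) :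
    waveJet l a (k + 6) x = -l ^ 6 * waveJet l a k x := by
  rw [waveJet, waveJet, add_comm, Function.iterate_add_apply, Coeffs.deriv_six]
  simp only [wave]
  ring

/-- A solution of the equation on `[-1, 1]` vanishes there if its derivatives of order at most
five vanish at `0`. The functions `w k` are the successive derivatives. -/
lemma eqOn_zero_of_initial_zero {l : ℝ} {w : ℕ → ℝ → ℝ}
    (hw : ∀ k < 6, ∀ x, HasDerivAt (w k) (w (k + 1) x) x)
    (h6 : ∀ x ∈ Icc (-1 : ℝ) 1, w 6 x = -l ^ 6 * w 0 x) (h0 : ∀ k < 6, w k 0 = 0) :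
    ∀ x ∈ Icc (-1 : ℝ) 1, w 0 x = 0 := by
  let v : (Fin 6 → ℝ) →ₗ[ℝ] (Fin 6 → ℝ) :=
    LinearMap.pi fun i => if h : (i : ℕ) < 5 then LinearMap.proj (⟨i + 1, by omega⟩ : Fin 6)
      else (-l ^ 6) • LinearMap.proj (0 : Fin 6)
  let V := LinearMap.toContinuousLinearMap v
  have hV (y : Fin 6 → ℝ) (i : Fin 6) : V y i =
      if h : (i : ℕ) < 5 then y ⟨i + 1, by omega⟩ else -l ^ 6 * y 0 := by
    change v y i = _
    simp only [v, LinearMap.pi_apply]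
    split_ifs <;> simp
  let f : ℝ → Fin 6 → ℝ := fun x i => w i x
  have hf : ∀ x ∈ Icc (-1 : ℝ) 1, HasDerivAt f (V (f x)) x := by
    intro x hx
    rw [hasDerivAt_pi]
    intro i
    rw [hV]
    split_ifs with h
    · exact hw i i.2 x
    · have hi : (i : ℕ) = 5 := by omega
      have := hw i i.2 x
      simp only [hi] at this
      rw [h6 x hx] at this
      simpa [f, hi] using this
  have key := ODE_solution_unique_of_mem_Icc (v := fun _ => V) (s := fun _ => univ) (a := -1)
    (b := 1) (t₀ := 0) (K := ‖V‖₊) (f := f) (g := fun _ => 0)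
    (fun _ _ => V.lipschitz.lipschitzOnWith) (by constructor <;> norm_num)
    (HasDerivAt.continuousOn hf) (fun t ht => hf t (Ioo_subset_Icc_self ht)) (fun _ _ => mem_univ _)
    continuousOn_const (fun t _ => by simpa using hasDerivAt_const t (0 : Fin 6 → ℝ))
    (fun _ _ => mem_univ _) (by ext i; exact h0 i i.2)
  intro x hx
  exact congrFun (key hx) 0

/-- Every solution of the equation on `[-1, 1]`, given with its derivatives, is a `wave`. -/
lemma exists_wave {l : ℝ} (hl : l ≠ 0) {u : ℕ → ℝ → ℝ}
    (hu : ∀ k < 6, ∀ x, HasDerivAt (u k) (u (k + 1) x) x)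
    (h6 : ∀ x ∈ Icc (-1 : ℝ) 1, u 6 x = -l ^ 6 * u 0 x) :
    ∃ a : Coeffs, ∀ x ∈ Icc (-1 : ℝ) 1, u 0 x = wave l a x := by
  have h3 := sqrt_three_sq
  have h3' : (√3 : ℝ) ≠ 0 := by positivity
  -- the coefficients solve the linear system that prescribes the derivatives at `0`
  let A0 := (u 0 0 + u 4 0 / l ^ 4 - u 2 0 / l ^ 2) / 3
  let A1 := (u 1 0 / l + u 5 0 / l ^ 5 - u 3 0 / l ^ 3) / 3
  let a : Coeffs := ⟨A0, A1, u 0 0 - A0, (u 2 0 / l ^ 2 + u 4 0 / l ^ 4) / √3,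
    u 3 0 / l ^ 3 + A1, (u 1 0 / l - u 5 0 / l ^ 5) / √3⟩
  have hz (b : Coeffs) : wave l b 0 = b.c + b.cc := by simp [wave]
  have hd : ∀ k, waveJet l a (k + 1) = waveJet l (a.deriv l) k := fun k => rfl
  have h4 (b : Coeffs) : waveJet l b 4 0 = l ^ 4 * b.c + l ^ 4 * (-(b.cc / 2) + √3 / 2 * b.ss) := by
    rw [waveJet, Coeffs.deriv_four, hz]
  have h2 (b : Coeffs) : waveJet l b 2 0 = -(l ^ 2 * b.c) + l ^ 2 * (b.cc / 2 + √3 / 2 * b.ss) := by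
    change wave l ((b.deriv l).deriv l) 0 = _
    rw [Coeffs.deriv_deriv, hz]
  have h0 (b : Coeffs) : waveJet l b 0 0 = b.c + b.cc := hz b
  refine ⟨a, fun x hx => ?_⟩
  have := eqOn_zero_of_initial_zero (l := l) (w := fun k x => u k x - waveJet l a k x)
    (fun k hk x => (hu k hk x).sub (hasDerivAt_waveJet l a k x))
    (fun x hx => by simp only [h6 x hx, waveJet_six_add l a 0 x]; ring) ?_ x hx
  · exact sub_eq_zero.1 this
  intro k hk
  simp only [sub_eq_zero]
  interval_cases k
  · simp only [h0, a]; ring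
  · simp only [hd, h0, Coeffs.deriv, a, A1]; field_simp; ring
  · simp only [h2, a, A0]; field_simp; ring
  · simp only [hd, h2, Coeffs.deriv, a, A1]
    field_simp
    ring_nf
    simp only [h3]
    ring
  · simp only [h4, a, A0]; field_simp; ring
  · simp only [hd, h4, Coeffs.deriv, a, A1]
    field_simp
    ring_nf
    simp only [h3]
    ring

/-! ### Eigenfunctions and their pairings -/

/-- `u` lists the successive derivatives of a global solution of `-f⁽⁶⁾ = l⁶ f` that satisfies the
six boundary conditions `f' = f'' = f⁽⁵⁾ = 0` at `±1`. -/
structure IsEigenJet (l : ℝ) (u : ℕ → ℝ → ℝ) : Prop where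
  deriv : ∀ k x, HasDerivAt (u k) (u (k + 1) x) x
  six : ∀ k x, u (k + 6) x = -l ^ 6 * u k x
  one : u 1 (-1) = 0 ∧ u 1 1 = 0
  two : u 2 (-1) = 0 ∧ u 2 1 = 0
  five : u 5 (-1) = 0 ∧ u 5 1 = 0

namespace IsEigenJet

variable {l m : ℝ} {u v : ℕ → ℝ → ℝ}

lemma iteratedDeriv_eq (h : IsEigenJet l u) (k : ℕ) : iteratedDeriv k (u 0) = u k := by
  induction k with
  | zero => simp
  | succ k ih =>
    rw [iteratedDeriv_succ, ih]
    exact funext fun x => (h.deriv k x).deriv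

lemma continuous (h : IsEigenJet l u) (k : ℕ) : Continuous (u k) :=
  continuous_iff_continuousAt.2 fun x => (h.deriv k x).continuousAt

lemma contDiff (h : IsEigenJet l u) : ContDiff ℝ 6 (u 0) := by
  rw [show (6 : WithTop ℕ∞) = ((6 : ℕ) : WithTop ℕ∞) from rfl, contDiff_nat_iff_iteratedDeriv]
  refine ⟨fun k _ => ?_, fun k _ => ?_⟩
  · rw [h.iteratedDeriv_eq]
    exact h.continuous k
  · rw [h.iteratedDeriv_eq]
    exact fun x => (h.deriv k x).differentiableAt

lemma derivOn_eq (h : IsEigenJet l u) {k : ℕ} (hk : k ≤ 6) {x : ℝ} (hx : x ∈ Icc (-1 : ℝ) 1) :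
    derivOn k (u 0) x = u k x := by
  rw [derivOn, iteratedDerivWithin_eq_iteratedDeriv (uniqueDiffOn_Icc (by norm_num)) _ hx,
    h.iteratedDeriv_eq]
  exact (h.contDiff.of_le (by exact_mod_cast hk)).contDiffAt

lemma isEigenfunction (h : IsEigenJet l u) (hne : ∃ x ∈ Icc (-1 : ℝ) 1, u 0 x ≠ 0) :
    IsEigenfunction l (u 0) := by
  have hm : (-1 : ℝ) ∈ Icc (-1 : ℝ) 1 := by constructor <;> norm_num
  have hp : (1 : ℝ) ∈ Icc (-1 : ℝ) 1 := by constructor <;> norm_num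
  refine ⟨h.contDiff.contDiffOn, hne, fun x hx => ?_, ?_, ?_, ?_⟩
  · rw [h.derivOn_eq le_rfl hx, h.six 0 x]
    ring
  · rw [h.derivOn_eq (by norm_num) hm, h.derivOn_eq (by norm_num) hp]
    exact h.one
  · rw [h.derivOn_eq (by norm_num) hm, h.derivOn_eq (by norm_num) hp]
    exact h.two
  · rw [h.derivOn_eq (by norm_num) hm, h.derivOn_eq (by norm_num) hp]
    exact h.five

/-- Eigenfunctions with different eigenvalues are orthogonal: Lagrange's identity, all of whose
boundary terms vanish. -/
lemma pairing_eq_zero (hu : IsEigenJet l u) (hv : IsEigenJet m v) (hlm : l ^ 6 ≠ m ^ 6) :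
    pairing (u 0) (v 0) = 0 := by
  have hW (x : ℝ) : HasDerivAt (fun x => u 5 x * v 0 x - u 4 x * v 1 x + u 3 x * v 2 x
      - u 2 x * v 3 x + u 1 x * v 4 x - u 0 x * v 5 x) ((m ^ 6 - l ^ 6) * (u 0 x * v 0 x)) x := by
    have := ((((((hu.deriv 5 x).mul (hv.deriv 0 x)).sub ((hu.deriv 4 x).mul (hv.deriv 1 x))).add
      ((hu.deriv 3 x).mul (hv.deriv 2 x))).sub ((hu.deriv 2 x).mul (hv.deriv 3 x))).add
      ((hu.deriv 1 x).mul (hv.deriv 4 x))).sub ((hu.deriv 0 x).mul (hv.deriv 5 x))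
    refine this.congr_deriv ?_
    have e1 := hu.six 0 x
    have e2 := hv.six 0 x
    norm_num at e1 e2 ⊢
    rw [e1, e2]
    ring
  have hc : Continuous fun x => (m ^ 6 - l ^ 6) * (u 0 x * v 0 x) :=
    ((hu.continuous 0).mul (hv.continuous 0)).const_mul _
  have key := intervalIntegral.integral_eq_sub_of_hasDerivAt (a := -1) (b := 1)
    (fun x _ => hW x) (hc.intervalIntegrable _ _)
  rw [intervalIntegral.integral_const_mul] at key
  simp only [hu.one, hu.two, hu.five, hv.one, hv.two, hv.five] at key
  norm_num at key
  rcases key with h | h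
  · exact absurd (sub_eq_zero.1 h).symm hlm
  · exact h

/-- The norm of an eigenfunction in terms of boundary values: the virial identity, obtained by
pairing `f` with `x f'`, which satisfies `-(x f')⁽⁶⁾ - l⁶ x f' = 6 l⁶ f`. -/
lemma six_mul_pairing_self (hu : IsEigenJet l u) :
    6 * l ^ 6 * pairing (u 0) (u 0) = l ^ 6 * u 0 1 ^ 2 + u 3 1 ^ 2
      + (l ^ 6 * u 0 (-1) ^ 2 + u 3 (-1) ^ 2) := by
  have hW (x : ℝ) : HasDerivAt (fun x => -((x * u 6 x + 5 * u 5 x) * u 0 x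
      - (x * u 5 x + 4 * u 4 x) * u 1 x + (x * u 4 x + 3 * u 3 x) * u 2 x
      - (x * u 3 x + 2 * u 2 x) * u 3 x + (x * u 2 x + u 1 x) * u 4 x - (x * u 1 x) * u 5 x))
      (6 * l ^ 6 * (u 0 x * u 0 x)) x := by
    have hx := hasDerivAt_id x
    have d (k : ℕ) := hu.deriv k x
    have := (((((((((hx.mul (d 6)).add ((d 5).const_mul 5)).mul (d 0)).sub
      (((hx.mul (d 5)).add ((d 4).const_mul 4)).mul (d 1))).add
      (((hx.mul (d 4)).add ((d 3).const_mul 3)).mul (d 2))).sub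
      (((hx.mul (d 3)).add ((d 2).const_mul 2)).mul (d 3))).add
      (((hx.mul (d 2)).add (d 1)).mul (d 4))).sub ((hx.mul (d 1)).mul (d 5)))).neg
    refine this.congr_deriv ?_
    have e1 := hu.six 0 x
    have e2 := hu.six 1 x
    norm_num at e1 e2 ⊢
    rw [e1, e2]
    ring
  have hc : Continuous fun x => 6 * l ^ 6 * (u 0 x * u 0 x) :=
    ((hu.continuous 0).mul (hu.continuous 0)).const_mul _
  have key := intervalIntegral.integral_eq_sub_of_hasDerivAt (a := -1) (b := 1)
    (fun x _ => hW x) (hc.intervalIntegrable _ _)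
  rw [intervalIntegral.integral_const_mul] at key
  rw [pairing, key]
  have e1 := hu.six 0 1
  have e2 := hu.six 0 (-1)
  norm_num at e1 e2
  simp only [hu.one, hu.two, hu.five, e1, e2]
  ring

lemma const_mul (hu : IsEigenJet l u) (N : ℝ) : IsEigenJet l (fun k x => N * u k x) where
  deriv k x := (hu.deriv k x).const_mul N
  six k x := by rw [hu.six]; ring
  one := by simp [hu.one]
  two := by simp [hu.two]
  five := by simp [hu.five]

end IsEigenJet

/-- The jet of the constant function `1`. -/
noncomputable def constJet (k : ℕ) (_ : ℝ) : ℝ := if k = 0 then 1 else 0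

lemma isEigenJet_constJet : IsEigenJet 0 constJet where
  deriv k x := by
    have : constJet (k + 1) x = 0 := by simp [constJet]
    rw [this]
    exact hasDerivAt_const x _
  six k x := by simp [constJet]
  one := by simp [constJet]
  two := by simp [constJet]
  five := by simp [constJet]

lemma constJet_zero : constJet 0 = psiZero := by
  ext x
  simp [constJet, psiZero]

lemma isEigenfunction_psiZero : IsEigenfunction 0 psiZero := by
  rw [← constJet_zero]
  exact isEigenJet_constJet.isEigenfunction ⟨0, by constructor <;> norm_num, by simp [constJet]⟩

/-! ### The boundary conditions for the explicit solutions -/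

/-- Coefficients of an even solution with `f'(±1) = f⁽⁵⁾(±1) = 0`; it is `evenPsi` without its
normalization and without the denominator. -/
noncomputable def evenCoeffs (l : ℝ) : Coeffs where
  c := cos l - cosh (√3 * l)
  s := 0
  cc := 4 * sin l * (sin (l / 2) * cosh (√3 * l / 2))
  ss := -(4 * sin l * (cos (l / 2) * sinh (√3 * l / 2)))
  sc := 0
  cs := 0

/-- Coefficients of an odd solution with `f'(±1) = f⁽⁵⁾(±1) = 0`; it is `oddPsi` without its
normalization and without the denominator. -/
noncomputable def oddCoeffs (l : ℝ) : Coeffs where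
  c := 0
  s := cos l + cosh (√3 * l)
  cc := 0
  ss := 0
  sc := -(4 * cos l * (cos (l / 2) * cosh (√3 * l / 2)))
  cs := 4 * cos l * (sin (l / 2) * sinh (√3 * l / 2))

lemma cos_lt_cosh {l : ℝ} (hl : l ≠ 0) : cos l < cosh (√3 * l) :=
  (cos_le_one l).trans_lt (one_lt_cosh.2 (by positivity))

lemma cos_add_cosh_pos {l : ℝ} (hl : l ≠ 0) : 0 < cos l + cosh (√3 * l) := by
  have h1 := neg_one_le_cos l
  have h2 : 1 < cosh (√3 * l) := one_lt_cosh.2 (by positivity)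
  linarith

lemma cos_eq_half (l : ℝ) : cos l = cos (l / 2) ^ 2 - sin (l / 2) ^ 2 := by
  rw [← cos_two_mul', mul_div_cancel₀ _ two_ne_zero]

lemma sin_eq_half (l : ℝ) : sin l = 2 * sin (l / 2) * cos (l / 2) := by
  rw [← sin_two_mul, mul_div_cancel₀ _ two_ne_zero]

lemma cosh_eq_half (l : ℝ) : cosh l = cosh (l / 2) ^ 2 + sinh (l / 2) ^ 2 := by
  rw [← cosh_two_mul, mul_div_cancel₀ _ two_ne_zero]

lemma sinh_eq_half (l : ℝ) : sinh l = 2 * sinh (l / 2) * cosh (l / 2) := by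
  rw [← sinh_two_mul, mul_div_cancel₀ _ two_ne_zero]

lemma wave_one (l : ℝ) (a : Coeffs) : wave l a 1 = a.c * cos l + a.s * sin l
    + a.cc * (cos (l / 2) * cosh (√3 * l / 2)) + a.ss * (sin (l / 2) * sinh (√3 * l / 2))
    + a.sc * (sin (l / 2) * cosh (√3 * l / 2)) + a.cs * (cos (l / 2) * sinh (√3 * l / 2)) := by
  simp [wave]

lemma wave_neg_one (l : ℝ) (a : Coeffs) : wave l a (-1) = a.c * cos l - a.s * sin l
    + a.cc * (cos (l / 2) * cosh (√3 * l / 2)) + a.ss * (sin (l / 2) * sinh (√3 * l / 2))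
    - a.sc * (sin (l / 2) * cosh (√3 * l / 2)) - a.cs * (cos (l / 2) * sinh (√3 * l / 2)) := by
  simp [wave]
  ring

lemma waveJet_two (l : ℝ) (a : Coeffs) : waveJet l a 2 = wave l ((a.deriv l).deriv l) := rfl

lemma waveJet_three (l : ℝ) (a : Coeffs) :
    waveJet l a 3 = wave l (((a.deriv l).deriv l).deriv l) := rfl

lemma waveJet_five (l : ℝ) (a : Coeffs) :
    waveJet l a 5 = wave l (((Coeffs.deriv l)^[4] a).deriv l) := by
  rw [waveJet, Function.iterate_succ_apply']

lemma sq_half_sub (l : ℝ) : (sin (l / 2) * cosh (√3 * l / 2)) ^ 2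
    + (cos (l / 2) * sinh (√3 * l / 2)) ^ 2 = (cosh (√3 * l) - cos l) / 2 := by
  have h3 := cosh_eq_half (√3 * l)
  have h4 := cos_eq_half l
  have h1 := sin_sq_add_cos_sq (l / 2)
  have h2 := cosh_sq (√3 * l / 2)
  linear_combination (sin (l / 2) ^ 2 - 1 / 2) * h2 + (sinh (√3 * l / 2) ^ 2 + 1 / 2) * h1
    - h3 / 2 + h4 / 2

lemma sq_half_add (l : ℝ) : (cos (l / 2) * cosh (√3 * l / 2)) ^ 2
    + (sin (l / 2) * sinh (√3 * l / 2)) ^ 2 = (cosh (√3 * l) + cos l) / 2 := by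
  have h3 := cosh_eq_half (√3 * l)
  have h4 := cos_eq_half l
  have h1 := sin_sq_add_cos_sq (l / 2)
  have h2 := cosh_sq (√3 * l / 2)
  linear_combination (cos (l / 2) ^ 2 - 1 / 2) * h2 + (sinh (√3 * l / 2) ^ 2 + 1 / 2) * h1
    - h3 / 2 - h4 / 2

/-- The conditions `f' = f⁽⁵⁾ = 0` at `±1` decouple into two conditions on the even part and two on
the odd part. -/
lemma first_fifth_conditions {l : ℝ} (hl : l ≠ 0) (a : Coeffs)
    (h1 : waveJet l a 1 (-1) = 0 ∧ waveJet l a 1 1 = 0)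
    (h5 : waveJet l a 5 (-1) = 0 ∧ waveJet l a 5 1 = 0) :
    (a.cc * (cos (l / 2) * sinh (√3 * l / 2)) + a.ss * (sin (l / 2) * cosh (√3 * l / 2)) = 0 ∧
      2 * a.c * sin l + a.cc * (sin (l / 2) * cosh (√3 * l / 2))
        - a.ss * (cos (l / 2) * sinh (√3 * l / 2)) = 0) ∧
    (a.sc * (sin (l / 2) * sinh (√3 * l / 2)) + a.cs * (cos (l / 2) * cosh (√3 * l / 2)) = 0 ∧
      2 * a.s * cos l + a.sc * (cos (l / 2) * cosh (√3 * l / 2))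
        - a.cs * (sin (l / 2) * sinh (√3 * l / 2)) = 0) := by
  have h3 := sqrt_three_sq
  have h3' : (√3 : ℝ) ≠ 0 := by positivity
  change wave l (a.deriv l) (-1) = 0 ∧ wave l (a.deriv l) 1 = 0 at h1
  rw [waveJet_five, Coeffs.deriv_four] at h5
  simp only [wave_one, wave_neg_one, Coeffs.deriv] at h1 h5
  generalize cos l = c at *
  generalize sin l = s at *
  generalize cos (l / 2) * cosh (√3 * l / 2) = CC at *
  generalize sin (l / 2) * sinh (√3 * l / 2) = SS at *
  generalize sin (l / 2) * cosh (√3 * l / 2) = SC at *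
  generalize cos (l / 2) * sinh (√3 * l / 2) = CS at *
  obtain ⟨h1m, h1p⟩ := h1
  obtain ⟨h5m, h5p⟩ := h5
  have hl5 : l ^ 5 ≠ 0 := pow_ne_zero _ hl
  refine ⟨⟨?_, ?_⟩, ?_, ?_⟩
  · apply mul_left_cancel₀ (mul_ne_zero hl5 h3')
    linear_combination l ^ 4 / 2 * (h1p - h1m) - (h5p - h5m) / 2
      - l ^ 5 / 4 * (a.cc * SC - a.ss * CS) * h3
  · apply mul_left_cancel₀ hl5
    linear_combination -l ^ 4 / 2 * (h1p - h1m) - (h5p - h5m) / 2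
      - l ^ 5 / 4 * (a.cc * SC - a.ss * CS) * h3
  · apply mul_left_cancel₀ (mul_ne_zero hl5 h3')
    linear_combination l ^ 4 / 2 * (h1p + h1m) - (h5p + h5m) / 2
      + l ^ 5 / 4 * (a.sc * CC - a.cs * SS) * h3
  · apply mul_left_cancel₀ hl5
    linear_combination l ^ 4 / 2 * (h1p + h1m) + (h5p + h5m) / 2
      - l ^ 5 / 4 * (a.sc * CC - a.cs * SS) * h3

lemma evenCoeffs_two (l : ℝ) :
    waveJet l (evenCoeffs l) 2 1 = -l ^ 2 * evenRelation l := by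
  have h3 := sqrt_three_sq
  rw [waveJet_two, Coeffs.deriv_deriv, wave_one]
  simp only [evenCoeffs, evenRelation, cos_two_mul']
  have e1 := sin_eq_half l
  have e2 := sinh_eq_half (√3 * l)
  have e3 := sin_sq_add_cos_sq (l / 2)
  have e4 := cosh_sq (√3 * l / 2)
  generalize cosh (√3 * l) = C at *
  generalize sinh (√3 * l) = S at *
  generalize cos l = c at *
  generalize sin l = s at *
  generalize cos (l / 2) = P at *
  generalize sin (l / 2) = Q at *
  generalize cosh (√3 * l / 2) = X at *
  generalize sinh (√3 * l / 2) = Y at *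
  generalize √3 = k at *
  grind

lemma oddCoeffs_two (l : ℝ) :
    waveJet l (oddCoeffs l) 2 1 = -l ^ 2 * oddRelation l := by
  have h3 := sqrt_three_sq
  rw [waveJet_two, Coeffs.deriv_deriv, wave_one]
  simp only [oddCoeffs, oddRelation, sin_two_mul]
  have e1 := sin_eq_half l
  have e2 := sinh_eq_half (√3 * l)
  have e3 := sin_sq_add_cos_sq (l / 2)
  have e4 := cosh_sq (√3 * l / 2)
  generalize cosh (√3 * l) = C at *
  generalize sinh (√3 * l) = S at *
  generalize cos l = c at *
  generalize sin l = s at *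
  generalize cos (l / 2) = P at *
  generalize sin (l / 2) = Q at *
  generalize cosh (√3 * l / 2) = X at *
  generalize sinh (√3 * l / 2) = Y at *
  generalize √3 = k at *
  grind

/-- For an even or odd solution the boundary conditions at `1` imply those at `-1`. -/
lemma isEigenJet_waveJet_of_right {l : ℝ} {a : Coeffs}
    (hpar : (a.s = 0 ∧ a.sc = 0 ∧ a.cs = 0) ∨ (a.c = 0 ∧ a.cc = 0 ∧ a.ss = 0))
    (h1 : waveJet l a 1 1 = 0) (h2 : waveJet l a 2 1 = 0) (h5 : waveJet l a 5 1 = 0) :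
    IsEigenJet l (waveJet l a) := by
  refine ⟨hasDerivAt_waveJet l a, waveJet_six_add l a, ⟨?_, h1⟩, ⟨?_, h2⟩, ⟨?_, h5⟩⟩
  · change wave l (a.deriv l) 1 = 0 at h1
    change wave l (a.deriv l) (-1) = 0
    simp only [wave_one, wave_neg_one, Coeffs.deriv] at h1 ⊢
    rcases hpar with ⟨p1, p2, p3⟩ | ⟨p1, p2, p3⟩ <;> simp only [p1, p2, p3] at h1 ⊢ <;>
      linarith
  · rw [waveJet_two, Coeffs.deriv_deriv] at h2 ⊢
    simp only [wave_one, wave_neg_one] at h2 ⊢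
    rcases hpar with ⟨p1, p2, p3⟩ | ⟨p1, p2, p3⟩ <;> simp only [p1, p2, p3] at h2 ⊢ <;>
      linarith
  · rw [waveJet_five, Coeffs.deriv_four] at h5 ⊢
    simp only [wave_one, wave_neg_one, Coeffs.deriv] at h5 ⊢
    rcases hpar with ⟨p1, p2, p3⟩ | ⟨p1, p2, p3⟩ <;> simp only [p1, p2, p3] at h5 ⊢ <;>
      linarith

lemma evenCoeffs_first_fifth (l : ℝ) :
    waveJet l (evenCoeffs l) 1 1 = 0 ∧ waveJet l (evenCoeffs l) 5 1 = 0 := by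
  have h3 := sqrt_three_sq
  have h := sq_half_sub l
  constructor
  · change wave l ((evenCoeffs l).deriv l) 1 = 0
    rw [wave_one]
    simp only [evenCoeffs, Coeffs.deriv]
    generalize sin (l / 2) * cosh (√3 * l / 2) = SC at *
    generalize cos (l / 2) * sinh (√3 * l / 2) = CS at *
    linear_combination -2 * l * sin l * h
  · rw [waveJet_five, Coeffs.deriv_four, wave_one]
    simp only [evenCoeffs, Coeffs.deriv]
    generalize sin (l / 2) * cosh (√3 * l / 2) = SC at *
    generalize cos (l / 2) * sinh (√3 * l / 2) = CS at *
    grind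

lemma oddCoeffs_first_fifth (l : ℝ) :
    waveJet l (oddCoeffs l) 1 1 = 0 ∧ waveJet l (oddCoeffs l) 5 1 = 0 := by
  have h3 := sqrt_three_sq
  have h := sq_half_add l
  constructor
  · change wave l ((oddCoeffs l).deriv l) 1 = 0
    rw [wave_one]
    simp only [oddCoeffs, Coeffs.deriv]
    generalize cos (l / 2) * cosh (√3 * l / 2) = CC at *
    generalize sin (l / 2) * sinh (√3 * l / 2) = SS at *
    linear_combination -2 * l * cos l * h
  · rw [waveJet_five, Coeffs.deriv_four, wave_one]
    simp only [oddCoeffs, Coeffs.deriv]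
    generalize cos (l / 2) * cosh (√3 * l / 2) = CC at *
    generalize sin (l / 2) * sinh (√3 * l / 2) = SS at *
    grind

lemma isEigenJet_evenCoeffs {l : ℝ} (h : evenRelation l = 0) :
    IsEigenJet l (waveJet l (evenCoeffs l)) :=
  isEigenJet_waveJet_of_right (Or.inl ⟨rfl, rfl, rfl⟩) (evenCoeffs_first_fifth l).1
    (by rw [evenCoeffs_two, h, mul_zero]) (evenCoeffs_first_fifth l).2

lemma isEigenJet_oddCoeffs {l : ℝ} (h : oddRelation l = 0) :
    IsEigenJet l (waveJet l (oddCoeffs l)) :=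
  isEigenJet_waveJet_of_right (Or.inr ⟨rfl, rfl, rfl⟩) (oddCoeffs_first_fifth l).1
    (by rw [oddCoeffs_two, h, mul_zero]) (oddCoeffs_first_fifth l).2

/-- Every eigenfunction with `l ≠ 0` is a combination of the explicit even and odd solutions, and
each of the two occurs only at a root of its relation. The functions `u k` are the successive
derivatives of the eigenfunction `u 0`. -/
lemma exists_eq_even_add_odd {l : ℝ} (hl : l ≠ 0) {u : ℕ → ℝ → ℝ}
    (hu : ∀ k < 6, ∀ x, HasDerivAt (u k) (u (k + 1) x) x)
    (h6 : ∀ x ∈ Icc (-1 : ℝ) 1, u 6 x = -l ^ 6 * u 0 x)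
    (h1 : u 1 (-1) = 0 ∧ u 1 1 = 0) (h2 : u 2 (-1) = 0 ∧ u 2 1 = 0)
    (h5 : u 5 (-1) = 0 ∧ u 5 1 = 0) :
    ∃ α β : ℝ, (α = 0 ∨ evenRelation l = 0) ∧ (β = 0 ∨ oddRelation l = 0) ∧
      ∀ x ∈ Icc (-1 : ℝ) 1, u 0 x = α * wave l (evenCoeffs l) x + β * wave l (oddCoeffs l) x := by
  obtain ⟨a, ha⟩ := exists_wave hl hu h6
  have hm : (-1 : ℝ) ∈ Icc (-1 : ℝ) 1 := by constructor <;> norm_num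
  have hp : (1 : ℝ) ∈ Icc (-1 : ℝ) 1 := by constructor <;> norm_num
  have hjet : ∀ k < 6, ∀ x ∈ Icc (-1 : ℝ) 1, u k x = waveJet l a k x := by
    intro k
    induction k with
    | zero => exact fun _ x hx => ha x hx
    | succ k ih =>
      intro hk x hx
      have hU : UniqueDiffWithinAt ℝ (Icc (-1 : ℝ) 1) x := uniqueDiffOn_Icc (by norm_num) x hx
      have e1 := (hu k (by omega) x).hasDerivWithinAt (s := Icc (-1 : ℝ) 1)
      have e2 := (hasDerivAt_waveJet l a k x).hasDerivWithinAt (s := Icc (-1 : ℝ) 1)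
      exact hU.eq_deriv _ e1 (e2.congr (ih (by omega)) (ih (by omega) x hx))
  simp only [hjet 1 (by norm_num) _ hm, hjet 1 (by norm_num) _ hp] at h1
  simp only [hjet 2 (by norm_num) _ hm, hjet 2 (by norm_num) _ hp] at h2
  simp only [hjet 5 (by norm_num) _ hm, hjet 5 (by norm_num) _ hp] at h5
  obtain ⟨⟨g1, g2⟩, g3, g4⟩ := first_fifth_conditions hl a h1 h5
  have hd := cos_lt_cosh hl
  have hs := cos_add_cosh_pos hl
  have hd0 : cos l - cosh (√3 * l) ≠ 0 := by linarith
  have hq := sq_half_sub l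
  have hr := sq_half_add l
  let α := a.c / (cos l - cosh (√3 * l))
  let β := a.s / (cos l + cosh (√3 * l))
  have hα : α * (cos l - cosh (√3 * l)) = a.c := div_mul_cancel₀ _ hd0
  have hβ : β * (cos l + cosh (√3 * l)) = a.s := div_mul_cancel₀ _ hs.ne'
  have hcc : a.cc = α * (evenCoeffs l).cc := by
    apply mul_left_cancel₀ hd0
    simp only [evenCoeffs]
    grind
  have hss : a.ss = α * (evenCoeffs l).ss := by
    apply mul_left_cancel₀ hd0
    simp only [evenCoeffs]
    grind
  have hsc : a.sc = β * (oddCoeffs l).sc := by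
    apply mul_left_cancel₀ hs.ne'
    simp only [oddCoeffs]
    grind
  have hcs : a.cs = β * (oddCoeffs l).cs := by
    apply mul_left_cancel₀ hs.ne'
    simp only [oddCoeffs]
    grind
  have hw (x : ℝ) : wave l a x = α * wave l (evenCoeffs l) x + β * wave l (oddCoeffs l) x := by
    simp only [wave, hcc, hss, hsc, hcs, ← hα, ← hβ, evenCoeffs, oddCoeffs]
    ring
  have hE := evenCoeffs_two l
  have hO := oddCoeffs_two l
  have hl2 : l ^ 2 ≠ 0 := pow_ne_zero _ hl
  rw [waveJet_two, Coeffs.deriv_deriv] at h2 hE hO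
  simp only [wave_one, wave_neg_one, hcc, hss, hsc, hcs, ← hα, ← hβ] at h2
  simp only [wave_one] at hE hO
  have hE' : α * evenRelation l = 0 := by
    apply mul_left_cancel₀ hl2
    simp only [evenCoeffs, oddCoeffs] at h2 hE
    linear_combination α * hE - (h2.1 + h2.2) / 2
  have hO' : β * oddRelation l = 0 := by
    apply mul_left_cancel₀ hl2
    simp only [evenCoeffs, oddCoeffs] at h2 hO
    linear_combination β * hO - (h2.2 - h2.1) / 2
  exact ⟨α, β, mul_eq_zero.1 hE', mul_eq_zero.1 hO', fun x hx => by rw [ha x hx, hw]⟩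

/-! ### Normalization -/

lemma sin_ne_zero_of_evenRelation {l : ℝ} (hl : l ≠ 0) (h : evenRelation l = 0) : sin l ≠ 0 := by
  intro hs
  have h1 : 1 < cosh (√3 * l) := one_lt_cosh.2 (by positivity)
  have h2 := sin_sq_add_cos_sq l
  rw [evenRelation, cos_two_mul, hs] at h
  rw [hs] at h2
  -- with `sin l = 0` the relation reads `cos l * cosh (√3 * l) = 1`, while `cos l = ±1`
  have h3 : cos l * cosh (√3 * l) = 1 := by linear_combination -h + 2 * h2
  have h4 : cosh (√3 * l) = cos l := by linear_combination cos l * h3 - cosh (√3 * l) * h2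
  linarith [cos_le_one l]

lemma cos_ne_zero_of_oddRelation {l : ℝ} (h : oddRelation l = 0) : cos l ≠ 0 := by
  intro hc
  have h2 := sin_sq_add_cos_sq l
  rw [oddRelation, sin_two_mul, hc] at h
  have hs : sin l = 0 := by
    have h3 : sin l * cosh (√3 * l) = 0 := by linear_combination h
    exact (mul_eq_zero.1 h3).resolve_right (cosh_pos _).ne'
  rw [hs, hc] at h2
  norm_num at h2

lemma sin_four_mul (l : ℝ) :
    sin (4 * l) = 4 * sin l * cos l * (cos l ^ 2 - sin l ^ 2) := by
  rw [show 4 * l = 2 * (2 * l) by ring, sin_two_mul, sin_two_mul, cos_two_mul']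
  ring

/-- At a root of the even relation, `evenD` is a sum of squares. -/
lemma evenD_eq {l : ℝ} (h : evenRelation l = 0) : evenD l =
    4 * l * sin l ^ 2 * ((√3 * sin l - sinh (√3 * l)) ^ 2 + 3 * (cos l - cosh (√3 * l)) ^ 2) := by
  have h1 := sin_sq_add_cos_sq l
  have h2 := cosh_sq (√3 * l)
  have h3 := sqrt_three_sq
  rw [evenRelation, cos_two_mul] at h
  rw [evenD, sin_four_mul, show 2 * √3 * l = 2 * (√3 * l) by ring, cosh_two_mul,
    cos_three_mul, sin_three_mul, sin_two_mul, cos_two_mul]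
  generalize cosh (√3 * l) = C at *
  generalize sinh (√3 * l) = S at *
  generalize cos l = c at *
  generalize sin l = s at *
  generalize √3 = k at *
  grind

/-- At a root of the odd relation, `oddD` is a sum of squares. -/
lemma oddD_eq {l : ℝ} (h : oddRelation l = 0) : oddD l =
    4 * l * cos l ^ 2 * ((√3 * sin l + sinh (√3 * l)) ^ 2 + 3 * (cos l + cosh (√3 * l)) ^ 2) := by
  have h1 := sin_sq_add_cos_sq l
  have h2 := cosh_sq (√3 * l)
  have h3 := sqrt_three_sq
  rw [oddRelation, sin_two_mul] at h
  rw [oddD, sin_four_mul, show 2 * √3 * l = 2 * (√3 * l) by ring, cosh_two_mul,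
    sin_two_mul, cos_two_mul]
  generalize cosh (√3 * l) = C at *
  generalize sinh (√3 * l) = S at *
  generalize cos l = c at *
  generalize sin l = s at *
  generalize √3 = k at *
  grind

lemma evenD_pos {l : ℝ} (hl : 0 < l) (h : evenRelation l = 0) : 0 < evenD l := by
  rw [evenD_eq h]
  have h1 := sin_ne_zero_of_evenRelation hl.ne' h
  have h2 : cos l - cosh (√3 * l) ≠ 0 := (sub_neg.2 (cos_lt_cosh hl.ne')).ne
  positivity

lemma oddD_pos {l : ℝ} (hl : 0 < l) (h : oddRelation l = 0) : 0 < oddD l := by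
  rw [oddD_eq h]
  have h1 := cos_ne_zero_of_oddRelation h
  have h2 : cos l + cosh (√3 * l) ≠ 0 := (cos_add_cosh_pos hl.ne').ne'
  positivity

lemma evenPsi_eq {l : ℝ} (hl : l ≠ 0) (x : ℝ) :
    evenPsi l x = 2 * √(l / evenD l) * wave l (evenCoeffs l) x := by
  have h2 : cos l - cosh (√3 * l) ≠ 0 := (sub_neg.2 (cos_lt_cosh hl)).ne
  rw [evenPsi, evenC, wave]
  simp only [evenCoeffs]
  generalize cos l - cosh (√3 * l) = d at *
  field_simp
  ring

lemma oddPsi_eq {l : ℝ} (hl : l ≠ 0) (x : ℝ) :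
    oddPsi l x = 2 * √(l / oddD l) * wave l (oddCoeffs l) x := by
  have h2 : cos l + cosh (√3 * l) ≠ 0 := (cos_add_cosh_pos hl).ne'
  rw [oddPsi, oddC, wave]
  simp only [oddCoeffs]
  generalize cos l + cosh (√3 * l) = d at *
  field_simp
  ring

/-- The values at `1` of the even solution and of its third derivative. -/
lemma evenCoeffs_values {l : ℝ} (h : evenRelation l = 0) :
    wave l (evenCoeffs l) 1 = √3 * sin l * (√3 * sin l - sinh (√3 * l)) ∧
    waveJet l (evenCoeffs l) 3 1 = l ^ 3 * (3 * sin l * (cos l - cosh (√3 * l))) := by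
  have h3 := sqrt_three_sq
  have hq := sq_half_sub l
  rw [waveJet_three, Coeffs.deriv_deriv, wave_one, wave_one]
  rw [evenRelation, cos_two_mul] at h
  simp only [evenCoeffs, Coeffs.deriv]
  have e1 := sin_eq_half l
  have e3 := sin_sq_add_cos_sq (l / 2)
  have e4 := cosh_sq (√3 * l / 2)
  have e5 := sin_sq_add_cos_sq l
  generalize cosh (√3 * l) = C at *
  generalize sinh (√3 * l) = S at *
  generalize cos l = c at *
  generalize sin l = s at *
  generalize cos (l / 2) = P at *
  generalize sin (l / 2) = Q at *
  generalize cosh (√3 * l / 2) = X at *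
  generalize sinh (√3 * l / 2) = Y at *
  generalize √3 = k at *
  constructor <;> grind

lemma oddCoeffs_values {l : ℝ} (h : oddRelation l = 0) :
    wave l (oddCoeffs l) 1 = -√3 * cos l * (√3 * sin l + sinh (√3 * l)) ∧
    waveJet l (oddCoeffs l) 3 1 = -l ^ 3 * (3 * cos l * (cos l + cosh (√3 * l))) := by
  have h3 := sqrt_three_sq
  have hq := sq_half_add l
  rw [waveJet_three, Coeffs.deriv_deriv, wave_one, wave_one]
  rw [oddRelation, sin_two_mul] at h
  simp only [oddCoeffs, Coeffs.deriv]
  have e1 := sin_eq_half l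
  have e3 := sin_sq_add_cos_sq (l / 2)
  have e4 := cosh_sq (√3 * l / 2)
  have e5 := sin_sq_add_cos_sq l
  generalize cosh (√3 * l) = C at *
  generalize sinh (√3 * l) = S at *
  generalize cos l = c at *
  generalize sin l = s at *
  generalize cos (l / 2) = P at *
  generalize sin (l / 2) = Q at *
  generalize cosh (√3 * l / 2) = X at *
  generalize sinh (√3 * l / 2) = Y at *
  generalize √3 = k at *
  constructor <;> grind

/-- The successive derivatives of `evenPsi l`. -/
noncomputable def evenPsiJet (l : ℝ) (k : ℕ) (x : ℝ) : ℝ :=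
  2 * √(l / evenD l) * waveJet l (evenCoeffs l) k x

/-- The successive derivatives of `oddPsi l`. -/
noncomputable def oddPsiJet (l : ℝ) (k : ℕ) (x : ℝ) : ℝ :=
  2 * √(l / oddD l) * waveJet l (oddCoeffs l) k x

lemma evenPsiJet_zero {l : ℝ} (hl : l ≠ 0) : evenPsiJet l 0 = evenPsi l :=
  funext fun x => (evenPsi_eq hl x).symm

lemma oddPsiJet_zero {l : ℝ} (hl : l ≠ 0) : oddPsiJet l 0 = oddPsi l :=
  funext fun x => (oddPsi_eq hl x).symm

lemma isEigenJet_evenPsiJet {l : ℝ} (h : evenRelation l = 0) : IsEigenJet l (evenPsiJet l) :=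
  (isEigenJet_evenCoeffs h).const_mul _

lemma isEigenJet_oddPsiJet {l : ℝ} (h : oddRelation l = 0) : IsEigenJet l (oddPsiJet l) :=
  (isEigenJet_oddCoeffs h).const_mul _

lemma even_evenPsi (l : ℝ) : Function.Even (evenPsi l) := fun x => by
  simp [evenPsi]

lemma odd_oddPsi (l : ℝ) : Function.Odd (oddPsi l) := fun x => by
  simp only [oddPsi, mul_neg, sin_neg, cos_neg, sinh_neg, cosh_neg]
  ring

lemma continuous_evenPsi {l : ℝ} (hl : l ≠ 0) : Continuous (evenPsi l) := by
  rw [← evenPsiJet_zero hl]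
  exact (continuous_waveJet l _ 0).const_mul _

lemma continuous_oddPsi {l : ℝ} (hl : l ≠ 0) : Continuous (oddPsi l) := by
  rw [← oddPsiJet_zero hl]
  exact (continuous_waveJet l _ 0).const_mul _

lemma pairing_evenPsi_self {l : ℝ} (hl : 0 < l) (h : evenRelation l = 0) :
    pairing (evenPsi l) (evenPsi l) = 1 := by
  have hd := evenD_pos hl h
  have hN : √(l / evenD l) ^ 2 = l / evenD l := Real.sq_sqrt (by positivity)
  have hD := evenD_eq h
  have h3 := sqrt_three_sq
  have key := (isEigenJet_evenPsiJet h).six_mul_pairing_self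
  rw [evenPsiJet_zero hl.ne', even_evenPsi l 1, evenPsi_eq hl.ne'] at key
  have hneg : evenPsiJet l 3 (-1) ^ 2 = evenPsiJet l 3 1 ^ 2 := by
    simp only [evenPsiJet, waveJet_three, wave_one, wave_neg_one, Coeffs.deriv,
      evenCoeffs]
    ring
  rw [hneg, evenPsiJet, (evenCoeffs_values h).1, (evenCoeffs_values h).2] at key
  apply mul_left_cancel₀ (mul_ne_zero (by norm_num : (6 : ℝ) ≠ 0) (pow_ne_zero 6 hl.ne'))
  apply mul_left_cancel₀ hd.ne'
  rw [key]
  generalize √(l / evenD l) = N at *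
  have hN' : N ^ 2 * evenD l = l := by rw [hN]; field_simp
  generalize evenD l = D at *
  generalize cosh (√3 * l) = C at *
  generalize sinh (√3 * l) = S at *
  generalize √3 = k at *
  linear_combination 8 * l ^ 6 * sin l ^ 2 * (k ^ 2 * (k * sin l - S) ^ 2
    + 9 * (cos l - C) ^ 2) * hN' - 6 * l ^ 6 * hD + 8 * l ^ 7 * sin l ^ 2 * (k * sin l - S) ^ 2 * h3

lemma pairing_oddPsi_self {l : ℝ} (hl : 0 < l) (h : oddRelation l = 0) :
    pairing (oddPsi l) (oddPsi l) = 1 := by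
  have hd := oddD_pos hl h
  have hN : √(l / oddD l) ^ 2 = l / oddD l := Real.sq_sqrt (by positivity)
  have hD := oddD_eq h
  have h3 := sqrt_three_sq
  have key := (isEigenJet_oddPsiJet h).six_mul_pairing_self
  rw [oddPsiJet_zero hl.ne', odd_oddPsi l 1, neg_sq, oddPsi_eq hl.ne'] at key
  have hneg : oddPsiJet l 3 (-1) ^ 2 = oddPsiJet l 3 1 ^ 2 := by
    simp only [oddPsiJet, waveJet_three, wave_one, wave_neg_one, Coeffs.deriv,
      oddCoeffs]
    ring
  rw [hneg, oddPsiJet, (oddCoeffs_values h).1, (oddCoeffs_values h).2] at key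
  apply mul_left_cancel₀ (mul_ne_zero (by norm_num : (6 : ℝ) ≠ 0) (pow_ne_zero 6 hl.ne'))
  apply mul_left_cancel₀ hd.ne'
  rw [key]
  generalize √(l / oddD l) = N at *
  have hN' : N ^ 2 * oddD l = l := by rw [hN]; field_simp
  generalize oddD l = D at *
  generalize cosh (√3 * l) = C at *
  generalize sinh (√3 * l) = S at *
  generalize √3 = k at *
  linear_combination 8 * l ^ 6 * cos l ^ 2 * (k ^ 2 * (k * sin l + S) ^ 2
    + 9 * (cos l + C) ^ 2) * hN' - 6 * l ^ 6 * hD + 8 * l ^ 7 * cos l ^ 2 * (k * sin l + S) ^ 2 * h3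

lemma exists_ne_zero_of_pairing_self {f : ℝ → ℝ} (h : pairing f f ≠ 0) :
    ∃ x ∈ Icc (-1 : ℝ) 1, f x ≠ 0 := by
  by_contra! hf
  apply h
  rw [pairing, intervalIntegral.integral_congr (g := fun _ => 0), intervalIntegral.integral_zero]
  intro x hx
  rw [uIcc_of_le (by norm_num)] at hx
  simp [hf x hx]

lemma isEigenfunction_evenPsi {l : ℝ} (hl : 0 < l) (h : evenRelation l = 0) :
    IsEigenfunction l (evenPsi l) := by
  have hne := exists_ne_zero_of_pairing_self (f := evenPsi l) (by
    rw [pairing_evenPsi_self hl h]; exact one_ne_zero)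
  rw [← evenPsiJet_zero hl.ne'] at hne ⊢
  exact (isEigenJet_evenPsiJet h).isEigenfunction hne

lemma isEigenfunction_oddPsi {l : ℝ} (hl : 0 < l) (h : oddRelation l = 0) :
    IsEigenfunction l (oddPsi l) := by
  have hne := exists_ne_zero_of_pairing_self (f := oddPsi l) (by
    rw [pairing_oddPsi_self hl h]; exact one_ne_zero)
  rw [← oddPsiJet_zero hl.ne'] at hne ⊢
  exact (isEigenJet_oddPsiJet h).isEigenfunction hne

lemma pairing_comm (f g : ℝ → ℝ) : pairing f g = pairing g f := by
  simp only [pairing, mul_comm]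

lemma pairing_even_odd {f g : ℝ → ℝ} (hf : Function.Even f) (hg : Function.Odd g) :
    pairing f g = 0 := by
  have h : pairing f g = -pairing f g := by
    conv_lhs => rw [pairing, ← neg_neg (1 : ℝ), ← intervalIntegral.integral_comp_neg]
    rw [pairing, ← intervalIntegral.integral_neg]
    simp only [neg_neg]
    congr 1
    ext x
    rw [hf x, hg x]
    ring
  linarith

lemma pow_six_ne {l m : ℝ} (hl : 0 ≤ l) (hm : 0 ≤ m) (h : l ≠ m) : l ^ 6 ≠ m ^ 6 :=
  fun e => h ((pow_left_inj₀ hl hm (by norm_num)).1 e)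

lemma continuous_mode {lc ls : ℕ+ → ℝ} (hc : ∀ m, 0 < lc m) (hs : ∀ m, 0 < ls m) (i : Mode) :
    Continuous (mode lc ls i) := by
  cases i with
  | const => exact continuous_const.div_const _
  | even m => exact continuous_evenPsi (hc m).ne'
  | odd m => exact continuous_oddPsi (hs m).ne'

/-- The modes are orthonormal in `L²[-1, 1]`. -/
lemma pairing_mode {lc ls : ℕ+ → ℝ} (hlc : Function.Injective lc) (hls : Function.Injective ls)
    (hc : ∀ m, 0 < lc m ∧ evenRelation (lc m) = 0) (hs : ∀ m, 0 < ls m ∧ oddRelation (ls m) = 0)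
    (i j : Mode) : (i = j → pairing (mode lc ls i) (mode lc ls j) = 1) ∧
      (i ≠ j → pairing (mode lc ls i) (mode lc ls j) = 0) := by
  have hconst (f : ℝ → ℝ) : pairing (fun x => psiZero x / √2) f = (√2)⁻¹ * pairing psiZero f := by
    simp only [pairing, psiZero]
    rw [← intervalIntegral.integral_const_mul]
    congr 1
    ext x
    ring
  have hce (m) : pairing psiZero (evenPsi (lc m)) = 0 := by
    rw [← constJet_zero, ← evenPsiJet_zero (hc m).1.ne']
    exact isEigenJet_constJet.pairing_eq_zero (isEigenJet_evenPsiJet (hc m).2)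
      (pow_six_ne le_rfl (hc m).1.le (hc m).1.ne)
  have hco (m) : pairing psiZero (oddPsi (ls m)) = 0 :=
    pairing_even_odd (fun _ => rfl) (odd_oddPsi _)
  have heo (m n) : pairing (evenPsi (lc m)) (oddPsi (ls n)) = 0 :=
    pairing_even_odd (even_evenPsi _) (odd_oddPsi _)
  constructor
  · rintro rfl
    cases i with
    | const =>
      simp only [mode, hconst]
      rw [pairing_comm, hconst]
      simp only [pairing, psiZero, mul_one, intervalIntegral.integral_const]
      rw [← mul_assoc, ← mul_inv, Real.mul_self_sqrt (by norm_num)]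
      norm_num
    | even m => exact pairing_evenPsi_self (hc m).1 (hc m).2
    | odd m => exact pairing_oddPsi_self (hs m).1 (hs m).2
  · intro hij
    cases i with
    | const =>
      cases j with
      | const => exact absurd rfl hij
      | even m => simp only [mode, hconst, hce, mul_zero]
      | odd m => simp only [mode, hconst, hco, mul_zero]
    | even m =>
      cases j with
      | const => rw [pairing_comm]; simp only [mode, hconst, hce, mul_zero]
      | even n =>
        have hmn : m ≠ n := fun e => hij (by rw [e])
        simp only [mode]
        rw [← evenPsiJet_zero (hc m).1.ne', ← evenPsiJet_zero (hc n).1.ne']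
        exact (isEigenJet_evenPsiJet (hc m).2).pairing_eq_zero (isEigenJet_evenPsiJet (hc n).2)
          (pow_six_ne (hc m).1.le (hc n).1.le (hlc.ne hmn))
      | odd n => exact heo m n
    | odd m =>
      cases j with
      | const => rw [pairing_comm]; simp only [mode, hconst, hco, mul_zero]
      | even n => rw [pairing_comm]; exact heo n m
      | odd n =>
        have hmn : m ≠ n := fun e => hij (by rw [e])
        simp only [mode]
        rw [← oddPsiJet_zero (hs m).1.ne', ← oddPsiJet_zero (hs n).1.ne']
        exact (isEigenJet_oddPsiJet (hs m).2).pairing_eq_zero (isEigenJet_oddPsiJet (hs n).2)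
          (pow_six_ne (hs m).1.le (hs n).1.le (hls.ne hmn))

/-! ### The positive roots -/

/-- An infinite set of positive reals with finitely many points below each bound can be listed in
increasing order. -/
lemma exists_strictMono_range_eq {s : Set ℝ} (hinf : s.Infinite)
    (hfin : ∀ R : ℝ, (s ∩ Iic R).Finite) : ∃ l : ℕ+ → ℝ, StrictMono l ∧ range l = s := by
  classical
  have hfin' (a b : s) : (Icc a b).Finite := by
    refine Finite.of_finite_image (f := Subtype.val) ((hfin b).subset ?_)
      Subtype.val_injective.injOn
    rintro _ ⟨x, hx, rfl⟩
    exact ⟨x.2, hx.2⟩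
  have : Nonempty s := hinf.nonempty.to_subtype
  let _ : LocallyFiniteOrder s := LocallyFiniteOrder.ofFiniteIcc hfin'
  obtain ⟨x0, hx0⟩ := hinf.nonempty
  obtain ⟨a, ha⟩ := ((hfin x0).exists_minimal ⟨x0, hx0, mem_Iic.2 le_rfl⟩)
  have hbot : ∀ b ∈ s, a ≤ b := by
    intro b hb
    rcases le_total b x0 with h | h
    · rcases le_total a b with h' | h'
      · exact h'
      · exact ha.2 ⟨hb, h⟩ h'
    · exact (ha.1.2 : a ≤ x0).trans h
  let _ : OrderBot s := { bot := ⟨a, ha.1.1⟩, bot_le := fun b => hbot b b.2 }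
  have hmax : NoMaxOrder s := by
    refine ⟨fun b => ?_⟩
    by_contra! h
    exact hinf ((hfin b).subset fun x hx => ⟨hx, h ⟨x, hx⟩⟩)
  let _ : SuccOrder s := LinearLocallyFiniteOrder.succOrder s
  let _ : PredOrder s := LinearLocallyFiniteOrder.predOrder s
  let e : s ≃o ℕ := orderIsoNatOfLinearSuccPredArch
  refine ⟨fun n => e.symm n.natPred, ?_, ?_⟩
  · intro m n hmn
    exact e.symm.strictMono (PNat.natPred_lt_natPred.2 hmn)
  · ext x
    constructor
    · rintro ⟨n, rfl⟩
      exact (e.symm _).2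
    · intro hx
      refine ⟨(e ⟨x, hx⟩).succPNat, ?_⟩
      simp

/-- A real-analytic function on the line that is not identically zero has finitely many positive
zeros below each bound. -/
lemma finite_zeros_of_analytic {F : ℝ → ℝ} (hF : AnalyticOnNhd ℝ F univ) {y : ℝ} (hy : F y ≠ 0)
    (R : ℝ) : ({x : ℝ | 0 < x ∧ F x = 0} ∩ Iic R).Finite := by
  by_contra hinf
  have hsub : {x : ℝ | 0 < x ∧ F x = 0} ∩ Iic R ⊆ Icc 0 R := fun x hx => ⟨hx.1.1.le, hx.2⟩
  obtain ⟨z, -, hz⟩ := Set.Infinite.exists_accPt_of_subset_isCompact hinf isCompact_Icc hsub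
  have hfreq : ∃ᶠ x in 𝓝[≠] z, F x = 0 := by
    rw [accPt_iff_frequently_nhdsNE] at hz
    exact hz.mono fun x hx => hx.1.2
  exact hy (hF.eqOn_zero_of_preconnected_of_frequently_eq_zero isPreconnected_univ (mem_univ z)
    hfreq (mem_univ y))

/-- A continuous function that changes sign on intervals `[a n, b n]` arbitrarily far to the right
has infinitely many positive zeros. -/
lemma infinite_zeros_of_alternating {F : ℝ → ℝ} (hF : Continuous F) {a b : ℕ → ℝ}
    (ha : ∀ n : ℕ, (n : ℝ) ≤ a n) (hab : ∀ n, a n < b n) (hFa : ∀ n, 0 < n → F (a n) * F (b n) < 0) :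
    {x : ℝ | 0 < x ∧ F x = 0}.Infinite := by
  intro hfin
  obtain ⟨B, hB⟩ := hfin.bddAbove
  obtain ⟨n, hn⟩ := exists_nat_gt (max B 0)
  have hn0 : (0 : ℝ) < n := (le_max_right _ _).trans_lt hn
  have hn' : 0 < n := by exact_mod_cast hn0
  have h0 : (0 : ℝ) ∈ uIcc (F (a n)) (F (b n)) := by
    rcases mul_neg_iff.1 (hFa n hn') with h | h
    · exact mem_uIcc.2 (Or.inr ⟨h.2.le, h.1.le⟩)
    · exact mem_uIcc.2 (Or.inl ⟨h.1.le, h.2.le⟩)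
  obtain ⟨x, hx, hx0⟩ := intermediate_value_uIcc hF.continuousOn h0
  rw [uIcc_of_le (hab n).le] at hx
  have hxn : (n : ℝ) ≤ x := (ha n).trans hx.1
  have := hB ⟨hn0.trans_le hxn, hx0⟩
  linarith [le_max_left B 0]

lemma analyticOnNhd_evenRelation : AnalyticOnNhd ℝ evenRelation univ := by
  suffices h : ContDiff ℝ ⊤ evenRelation from
    fun x _ => h.contDiffAt.analyticAt
  unfold evenRelation
  have h (k : ℝ) : ContDiff ℝ ⊤ (fun x : ℝ => k * x) := by fun_prop
  exact ((contDiff_cos.comp (h 2)).add ((contDiff_const.mul contDiff_sin).mul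
    (contDiff_sinh.comp (h _)))).sub (contDiff_cos.mul (contDiff_cosh.comp (h _)))

lemma analyticOnNhd_oddRelation : AnalyticOnNhd ℝ oddRelation univ := by
  suffices h : ContDiff ℝ ⊤ oddRelation from
    fun x _ => h.contDiffAt.analyticAt
  unfold oddRelation
  have h (k : ℝ) : ContDiff ℝ ⊤ (fun x : ℝ => k * x) := by fun_prop
  exact ((contDiff_sin.comp (h 2)).add ((contDiff_const.mul contDiff_cos).mul
    (contDiff_sinh.comp (h _)))).add (contDiff_sin.mul (contDiff_cosh.comp (h _)))

lemma evenRelation_two_pi {n : ℕ} (hn : 0 < n) : evenRelation (n * (2 * π)) < 0 := by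
  have hn' : (0 : ℝ) < n := by exact_mod_cast hn
  have h1 : 1 < cosh (√3 * (n * (2 * π))) := one_lt_cosh.2 (by positivity)
  have hs : sin (n * (2 * π)) = 0 := by simpa using sin_nat_mul_two_pi_sub 0 n
  rw [evenRelation, cos_two_mul, cos_nat_mul_two_pi, hs]
  linarith

lemma evenRelation_two_pi_add_pi (n : ℕ) : 0 < evenRelation (n * (2 * π) + π) := by
  have hs : sin (n * (2 * π)) = 0 := by simpa using sin_nat_mul_two_pi_sub 0 n
  have h1 := cosh_pos (√3 * (n * (2 * π) + π))
  rw [evenRelation, cos_two_mul, cos_add_pi, sin_add_pi, cos_nat_mul_two_pi, hs]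
  linarith

lemma oddRelation_two_pi_add (n : ℕ) : 0 < oddRelation (n * (2 * π) + π / 2) := by
  have hs : sin (n * (2 * π)) = 0 := by simpa using sin_nat_mul_two_pi_sub 0 n
  have h1 := cosh_pos (√3 * (n * (2 * π) + π / 2))
  rw [oddRelation, sin_two_mul, cos_add_pi_div_two, sin_add_pi_div_two, cos_nat_mul_two_pi, hs]
  linarith

lemma oddRelation_two_pi_add_pi (n : ℕ) : oddRelation (n * (2 * π) + π / 2 + π) < 0 := by
  have hs : sin (n * (2 * π)) = 0 := by simpa using sin_nat_mul_two_pi_sub 0 n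
  have h1 := cosh_pos (√3 * (n * (2 * π) + π / 2 + π))
  rw [oddRelation, sin_two_mul, cos_add_pi, sin_add_pi, cos_add_pi_div_two, sin_add_pi_div_two,
    cos_nat_mul_two_pi, hs]
  linarith

lemma exists_enumeratesPositiveRoots_even :
    ∃ l : ℕ+ → ℝ, EnumeratesPositiveRoots evenRelation l := by
  have hA := analyticOnNhd_evenRelation
  have hc : Continuous evenRelation := continuousOn_univ.1 hA.continuousOn
  refine exists_strictMono_range_eq (infinite_zeros_of_alternating hc
    (a := fun n => n * (2 * π)) (b := fun n => n * (2 * π) + π) (fun n => ?_) (fun n => ?_)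
    (fun n hn => ?_)) (finite_zeros_of_analytic hA (evenRelation_two_pi_add_pi 0).ne')
  · have : (0 : ℝ) ≤ n := n.cast_nonneg
    nlinarith [pi_gt_three]
  · linarith [pi_pos]
  · exact mul_neg_of_neg_of_pos (evenRelation_two_pi hn) (evenRelation_two_pi_add_pi n)

lemma exists_enumeratesPositiveRoots_odd :
    ∃ l : ℕ+ → ℝ, EnumeratesPositiveRoots oddRelation l := by
  have hA := analyticOnNhd_oddRelation
  have hc : Continuous oddRelation := continuousOn_univ.1 hA.continuousOn
  refine exists_strictMono_range_eq (infinite_zeros_of_alternating hc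
    (a := fun n => n * (2 * π) + π / 2) (b := fun n => n * (2 * π) + π / 2 + π) (fun n => ?_)
    (fun n => ?_) (fun n hn => ?_)) (finite_zeros_of_analytic hA (oddRelation_two_pi_add 0).ne')
  · have : (0 : ℝ) ≤ n := n.cast_nonneg
    nlinarith [pi_gt_three]
  · linarith [pi_pos]
  · exact mul_neg_of_pos_of_neg (oddRelation_two_pi_add n) (oddRelation_two_pi_add_pi n)

/-! ### A skew-adjoint Volterra operator -/

/-- The real Hilbert space `L²[-1, 1]`. -/
abbrev L2Space : Type := Lp ℝ 2 intervalMeasure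

/-- The indicator function of `[-1, x]` as an element of `L²[-1, 1]`. -/
noncomputable def cutoff (x : ℝ) : L2Space :=
  indicatorConstLp 2 (measurableSet_Iic (a := x)) (measure_ne_top intervalMeasure _) (1 : ℝ)

lemma inner_cutoff (x : ℝ) (f : L2Space) :
    inner ℝ (cutoff x) f = ∫ y in Iic x, f y ∂intervalMeasure :=
  L2.inner_indicatorConstLp_one _ _ f

lemma continuous_cutoff : Continuous cutoff := by
  refine continuous_indicatorConstLp_set (by norm_num) fun x => ?_
  have hle (y : ℝ) : intervalMeasure (symmDiff (Iic y) (Iic x)) ≤ ENNReal.ofReal |y - x| := by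
    refine (Measure.restrict_apply_le _ _).trans ?_
    rcases le_total x y with h | h
    · have : symmDiff (Iic y) (Iic x) ⊆ Ioc x y := by
        rintro z (⟨h1, h2⟩ | ⟨h1, h2⟩)
        · exact ⟨not_le.1 h2, h1⟩
        · exact absurd (h1.trans h) h2
      refine (measure_mono this).trans_eq ?_
      rw [Real.volume_Ioc, abs_of_nonneg (by linarith)]
    · have : symmDiff (Iic y) (Iic x) ⊆ Ioc y x := by
        rintro z (⟨h1, h2⟩ | ⟨h1, h2⟩)
        · exact absurd (h1.trans h) h2
        · exact ⟨not_le.1 h2, h1⟩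
      refine (measure_mono this).trans_eq ?_
      rw [Real.volume_Ioc, abs_of_nonpos (by linarith), neg_sub]
  refine tendsto_of_tendsto_of_tendsto_of_le_of_le tendsto_const_nhds ?_ (fun _ => zero_le) hle
  have : Continuous fun y : ℝ => ENNReal.ofReal |y - x| :=
    ENNReal.continuous_ofReal.comp (by fun_prop)
  simpa using this.tendsto x

/-- The element `1` of `L²[-1, 1]`. -/
noncomputable def oneL2 : L2Space := cutoff 1

lemma oneL2_ae : (oneL2 : ℝ → ℝ) =ᵐ[intervalMeasure] fun _ => 1 := by
  have h : (oneL2 : ℝ → ℝ) =ᵐ[intervalMeasure] _ :=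
    indicatorConstLp_coeFn (hs := measurableSet_Iic) (hμs := measure_ne_top intervalMeasure _)
  filter_upwards [h, ae_restrict_mem measurableSet_Icc] with x hx hx1
  rw [hx, indicator_of_mem (mem_Iic.2 hx1.2)]

/-- The integral kernel `sign (x - y) / 2`, as a continuous family of elements of `L²[-1, 1]`. -/
noncomputable def signKernel (x : ℝ) : L2Space := cutoff x - (1 / 2 : ℝ) • oneL2

lemma continuous_signKernel : Continuous signKernel := continuous_cutoff.sub continuous_const

lemma inner_signKernel (x : ℝ) (f : L2Space) :
    inner ℝ (signKernel x) f = inner ℝ (cutoff x) f - 1 / 2 * inner ℝ oneL2 f := by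
  rw [signKernel, inner_sub_left, real_inner_smul_left]

/-- The operator `f ↦ (x ↦ ⟪k x, f⟫)` from a Hilbert space to the continuous functions on
`[-1, 1]`. -/
noncomputable def kernelMap {H : Type*} [NormedAddCommGroup H] [InnerProductSpace ℝ H]
    (k : C(Icc (-1 : ℝ) 1, H)) : H →L[ℝ] BoundedContinuousFunction (Icc (-1 : ℝ) 1) ℝ :=
  LinearMap.mkContinuous
    { toFun := fun f => BoundedContinuousFunction.mkOfCompact
        ⟨fun x => inner ℝ (k x) f, by fun_prop⟩
      map_add' := fun f g => by ext x; simp [inner_add_right]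
      map_smul' := fun c f => by ext x; simp [inner_smul_right] }
    ‖k‖ fun f => by
      refine (BoundedContinuousFunction.norm_le (by positivity)).2 fun x => ?_
      exact (norm_inner_le_norm _ _).trans
        (mul_le_mul_of_nonneg_right (k.norm_coe_le_norm x) (norm_nonneg _))

lemma kernelMap_apply {H : Type*} [NormedAddCommGroup H] [InnerProductSpace ℝ H]
    (k : C(Icc (-1 : ℝ) 1, H)) (f : H) (x : Icc (-1 : ℝ) 1) :
    kernelMap k f x = inner ℝ (k x) f := rfl

/-- By the Arzelà–Ascoli theorem, since `k` is continuous on a compact interval. -/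
lemma isCompactOperator_kernelMap {H : Type*} [NormedAddCommGroup H] [InnerProductSpace ℝ H]
    (k : C(Icc (-1 : ℝ) 1, H)) : IsCompactOperator (kernelMap k) := by
  rw [isCompactOperator_iff_exists_mem_nhds_isCompact_closure_image]
  refine ⟨Metric.ball 0 1, Metric.ball_mem_nhds _ one_pos, ?_⟩
  refine BoundedContinuousFunction.arzela_ascoli (Metric.closedBall (0 : ℝ) ‖k‖)
    (isCompact_closedBall _ _) _ ?_ ?_
  · rintro _ x ⟨f, hf, rfl⟩
    rw [mem_closedBall_zero_iff, kernelMap_apply]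
    have hf' : ‖f‖ ≤ 1 := (mem_ball_zero_iff.1 hf).le
    calc ‖inner ℝ (k x) f‖ ≤ ‖k x‖ * ‖f‖ := norm_inner_le_norm _ _
      _ ≤ ‖k‖ * 1 := mul_le_mul (k.norm_coe_le_norm x) hf' (norm_nonneg _) (norm_nonneg _)
      _ = ‖k‖ := mul_one _
  · intro x
    rw [Metric.equicontinuousAt_iff]
    intro ε hε
    obtain ⟨δ, hδ, h⟩ := Metric.continuousAt_iff.1 (k.continuous.continuousAt (x := x)) ε hε
    refine ⟨δ, hδ, fun y hy => ?_⟩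
    rintro ⟨_, f, hf, rfl⟩
    have hf' : ‖f‖ ≤ 1 := (mem_ball_zero_iff.1 hf).le
    change dist (inner ℝ (k x) f) (inner ℝ (k y) f) < ε
    rw [dist_eq_norm, ← inner_sub_left]
    calc ‖inner ℝ (k x - k y) f‖ ≤ ‖k x - k y‖ * ‖f‖ := norm_inner_le_norm _ _
      _ ≤ ‖k x - k y‖ * 1 := mul_le_mul_of_nonneg_left hf' (norm_nonneg _)
      _ < ε := by rw [mul_one, ← dist_eq_norm, dist_comm]; exact h hy

/-- Extension of continuous functions from `[-1, 1]` to the line by constants. -/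
noncomputable def extendConst : BoundedContinuousFunction (Icc (-1 : ℝ) 1) ℝ →L[ℝ]
    BoundedContinuousFunction ℝ ℝ :=
  LinearMap.mkContinuous
    ({ toFun := fun g => g.compContinuous
          ⟨projIcc (-1 : ℝ) 1 (by norm_num), continuous_projIcc⟩
       map_add' := fun _ _ => rfl
       map_smul' := fun _ _ => rfl } : BoundedContinuousFunction (Icc (-1 : ℝ) 1) ℝ →ₗ[ℝ]
        BoundedContinuousFunction ℝ ℝ)
    1 fun g => by
      rw [one_mul]
      exact BoundedContinuousFunction.norm_compContinuous_le _ _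

/-- Continuous functions on `[-1, 1]` as elements of `L²[-1, 1]`. -/
noncomputable def toL2 : BoundedContinuousFunction (Icc (-1 : ℝ) 1) ℝ →L[ℝ] L2Space :=
  (BoundedContinuousFunction.toLp 2 intervalMeasure ℝ).comp extendConst

lemma toL2_ae (g : BoundedContinuousFunction (Icc (-1 : ℝ) 1) ℝ) :
    (toL2 g : ℝ → ℝ) =ᵐ[intervalMeasure] fun x => g (projIcc (-1 : ℝ) 1 (by norm_num) x) :=
  BoundedContinuousFunction.coeFn_toLp 2 intervalMeasure ℝ (extendConst g)

/-- The operator `(A f) x = ½ ∫_{-1}^x f - ½ ∫_x^1 f` on `L²[-1, 1]`, a skew-adjoint right inverse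
of `d/dx`. -/
noncomputable def skewPrim : L2Space →L[ℝ] L2Space :=
  toL2.comp (kernelMap ⟨fun x => signKernel x, continuous_signKernel.comp continuous_subtype_val⟩)

lemma isCompactOperator_skewPrim : IsCompactOperator skewPrim :=
  (isCompactOperator_kernelMap _).clm_comp toL2

lemma skewPrim_ae (f : L2Space) :
    (skewPrim f : ℝ → ℝ) =ᵐ[intervalMeasure] fun x => inner ℝ (signKernel x) f := by
  filter_upwards [toL2_ae (kernelMap ⟨fun x => signKernel x,
    continuous_signKernel.comp continuous_subtype_val⟩ f), ae_restrict_mem measurableSet_Icc]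
    with x hx hx1
  rw [skewPrim, ContinuousLinearMap.comp_apply, hx, projIcc_of_mem _ hx1]
  rfl

lemma inner_eq_integral (f g : L2Space) :
    inner ℝ f g = ∫ x, f x * g x ∂intervalMeasure := by
  rw [L2.inner_def]
  simp [mul_comm]

lemma integrable_L2 (f : L2Space) : Integrable f intervalMeasure :=
  (Lp.memLp f).integrable (by norm_num)

lemma inner_oneL2 (f : L2Space) : inner ℝ oneL2 f = ∫ x, f x ∂intervalMeasure := by
  rw [inner_eq_integral]
  refine integral_congr_ae ?_
  filter_upwards [oneL2_ae] with x hx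
  rw [hx, one_mul]

/-- Integration by parts for the two primitives, from Fubini's theorem on the triangle `y ≤ x`. -/
lemma integral_cutoff_mul_add (f g : L2Space) :
    ∫ x, inner ℝ (cutoff x) f * g x ∂intervalMeasure
      + ∫ x, f x * inner ℝ (cutoff x) g ∂intervalMeasure = inner ℝ oneL2 f * inner ℝ oneL2 g := by
  let φ : ℝ → ℝ → ℝ := fun x y => (Iic x).indicator (fun y => f y) y * g x
  have hφ : Integrable (Function.uncurry φ) (intervalMeasure.prod intervalMeasure) := by
    have h1 : Integrable (fun z : ℝ × ℝ => g z.1 * f z.2)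
        (intervalMeasure.prod intervalMeasure) := (integrable_L2 g).mul_prod (integrable_L2 f)
    have h2 := h1.indicator (s := {z : ℝ × ℝ | z.2 ≤ z.1})
      (measurableSet_le measurable_snd measurable_fst)
    refine h2.congr (Eventually.of_forall fun z => ?_)
    by_cases hz : z.2 ≤ z.1
    · have : z.2 ∈ Iic z.1 := hz
      simp [Function.uncurry, φ, hz, mul_comm]
    · simp [Function.uncurry, φ, hz]
  have hx (x : ℝ) : ∫ y, φ x y ∂intervalMeasure = inner ℝ (cutoff x) f * g x := by
    simp only [φ]
    rw [integral_mul_const, integral_indicator measurableSet_Iic, inner_cutoff]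
  have hy (y : ℝ) : ∫ x, φ x y ∂intervalMeasure
      = f y * inner ℝ oneL2 g - f y * inner ℝ (cutoff y) g := by
    have e : ∀ x, φ x y = (Ici y).indicator (fun x => f y * g x) x := by
      intro x
      by_cases hxy : y ≤ x
      · simp [φ, hxy]
      · simp [φ, hxy]
    simp only [e]
    rw [integral_indicator measurableSet_Ici, integral_const_mul, inner_oneL2, inner_cutoff,
      ← mul_sub, integral_Ici_eq_integral_Ioi]
    have := integral_add_compl (measurableSet_Iic (a := y)) (integrable_L2 g)
    rw [compl_Iic] at this
    rw [← this]
    ring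
  have key := integral_integral_swap hφ
  have hint := hφ.integral_prod_right
  simp only [Function.uncurry] at hint
  simp only [hx, hy] at key hint
  have hint1 : Integrable (fun y => f y * inner ℝ oneL2 g) intervalMeasure :=
    (integrable_L2 f).mul_const _
  have hint2 : Integrable (fun y => f y * inner ℝ (cutoff y) g) intervalMeasure := by
    refine (hint1.sub hint).congr (Eventually.of_forall fun y => ?_)
    simp
  rw [integral_sub hint1 hint2, integral_mul_const] at key
  rw [key, inner_oneL2 f]
  ring

lemma skewPrim_skew (f g : L2Space) : inner ℝ (skewPrim f) g = -inner ℝ f (skewPrim g) := by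
  have hc (f : L2Space) : Continuous fun x => inner ℝ (cutoff x) f :=
    continuous_cutoff.inner continuous_const
  have hi (f g : L2Space) : Integrable (fun x => inner ℝ (cutoff x) f * g x) intervalMeasure := by
    have hs : Integrable (fun x => inner ℝ (signKernel x) f * g x) intervalMeasure := by
      refine (L2.integrable_inner (𝕜 := ℝ) g (skewPrim f)).congr ?_
      filter_upwards [skewPrim_ae f] with x hx
      rw [← hx]
      rfl
    refine (hs.add ((integrable_L2 g).const_mul (1 / 2 * inner ℝ oneL2 f))).congr
      (Eventually.of_forall fun x => ?_)
    simp only [Pi.add_apply, inner_signKernel]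
    ring
  have h (f g : L2Space) : inner ℝ (skewPrim f) g
      = ∫ x, inner ℝ (cutoff x) f * g x ∂intervalMeasure
        - 1 / 2 * inner ℝ oneL2 f * inner ℝ oneL2 g := by
    rw [inner_eq_integral, inner_oneL2 g, ← integral_const_mul, ← integral_sub (hi f g)
      ((integrable_L2 g).const_mul _)]
    refine integral_congr_ae ?_
    filter_upwards [skewPrim_ae f] with x hx
    rw [hx, inner_signKernel]
    ring
  rw [real_inner_comm (skewPrim g) f, h, h]
  have key := integral_cutoff_mul_add f g
  have e : ∫ x, f x * inner ℝ (cutoff x) g ∂intervalMeasure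
      = ∫ x, inner ℝ (cutoff x) g * f x ∂intervalMeasure := by
    simp only [mul_comm]
  rw [e] at key
  linear_combination key

/-- A function whose integrals over all `[-1, x]` vanish is zero. -/
lemma eq_zero_of_inner_cutoff {f : L2Space} (h : ∀ x, inner ℝ (cutoff x) f = 0) : f = 0 := by
  have hf := integrable_L2 f
  have htot : ∫ x, f x ∂intervalMeasure = 0 := by
    rw [← inner_oneL2]
    exact h 1
  have hset : ∀ s, MeasurableSet s → ∫ x in s, f x ∂intervalMeasure = 0 := by
    intro s hs
    refine MeasurableSpace.induction_on_inter
      (C := fun s _ => ∫ x in s, f x ∂intervalMeasure = 0)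
      (borel_eq_generateFrom_Iic ℝ ▸ BorelSpace.measurable_eq) isPiSystem_Iic ?_ ?_ ?_ ?_ s hs
    · simp
    · rintro _ ⟨x, rfl⟩
      rw [← inner_cutoff]
      exact h x
    · intro t ht h0
      have := integral_add_compl ht hf
      rwa [h0, zero_add, htot] at this
    · intro t hd ht h0
      rw [integral_iUnion ht hd hf.integrableOn]
      simp [h0]
  refine Lp.ext ?_
  refine (hf.ae_eq_zero_of_forall_setIntegral_eq_zero fun s hs _ => hset s hs).trans ?_
  exact (Lp.coeFn_zero _ _ _).symm

/-! ### Regularity -/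

/-- The pointwise form of `skewPrim` on continuous functions. -/
noncomputable def prim (g : ℝ → ℝ) (x : ℝ) : ℝ :=
  (∫ y in (-1 : ℝ)..x, g y) - 1 / 2 * ∫ y in (-1 : ℝ)..1, g y

lemma hasDerivAt_prim {g : ℝ → ℝ} (hg : Continuous g) (x : ℝ) : HasDerivAt (prim g) (g x) x :=
  (intervalIntegral.integral_hasDerivAt_right (hg.intervalIntegrable _ _)
    (hg.stronglyMeasurableAtFilter _ _) hg.continuousAt).sub_const _

lemma continuous_prim {g : ℝ → ℝ} (hg : Continuous g) : Continuous (prim g) :=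
  continuous_iff_continuousAt.2 fun x => (hasDerivAt_prim hg x).continuousAt

lemma integral_intervalMeasure (g : ℝ → ℝ) :
    ∫ x, g x ∂intervalMeasure = ∫ x in (-1 : ℝ)..1, g x := by
  rw [intervalIntegral.integral_of_le (by norm_num), integral_Icc_eq_integral_Ioc]

lemma inner_cutoff_eq_intervalIntegral {f : L2Space} {g : ℝ → ℝ} (hfg : f =ᵐ[intervalMeasure] g)
    {x : ℝ} (hx : x ∈ Icc (-1 : ℝ) 1) : inner ℝ (cutoff x) f = ∫ y in (-1 : ℝ)..x, g y := by
  have hs : Iic x ∩ Icc (-1 : ℝ) 1 = Icc (-1) x := by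
    ext y
    simp only [mem_inter_iff, mem_Iic, mem_Icc]
    constructor
    · rintro ⟨h1, h2, -⟩
      exact ⟨h2, h1⟩
    · rintro ⟨h1, h2⟩
      exact ⟨h2, h1, h2.trans hx.2⟩
  rw [inner_cutoff, intervalIntegral.integral_of_le hx.1, ← integral_Icc_eq_integral_Ioc,
    integral_congr_ae (ae_restrict_of_ae hfg), intervalMeasure,
    Measure.restrict_restrict measurableSet_Iic, hs]

lemma inner_oneL2_eq_intervalIntegral {f : L2Space} {g : ℝ → ℝ} (hfg : f =ᵐ[intervalMeasure] g) :
    inner ℝ oneL2 f = ∫ y in (-1 : ℝ)..1, g y :=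
  inner_cutoff_eq_intervalIntegral hfg ⟨by norm_num, le_rfl⟩

lemma skewPrim_ae_prim {f : L2Space} {g : ℝ → ℝ} (hfg : f =ᵐ[intervalMeasure] g) :
    (skewPrim f : ℝ → ℝ) =ᵐ[intervalMeasure] prim g := by
  filter_upwards [skewPrim_ae f, ae_restrict_mem measurableSet_Icc] with x hx hx1
  rw [hx, inner_signKernel, inner_cutoff_eq_intervalIntegral hfg hx1,
    inner_oneL2_eq_intervalIntegral hfg, prim]

lemma prim_endpoints {f : L2Space} {g : ℝ → ℝ} (hfg : f =ᵐ[intervalMeasure] g)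
    (h0 : inner ℝ oneL2 f = 0) : prim g (-1) = 0 ∧ prim g 1 = 0 := by
  rw [inner_oneL2_eq_intervalIntegral hfg] at h0
  simp [prim, h0]

lemma eqOn_Icc_of_ae {f g : ℝ → ℝ} (h : f =ᵐ[intervalMeasure] g) (hf : Continuous f)
    (hg : Continuous g) : EqOn f g (Icc (-1) 1) :=
  Measure.eqOn_Icc_of_ae_eq volume (by norm_num) h hf.continuousOn hg.continuousOn

/-- The element `x` of `L²[-1, 1]`. -/
noncomputable def idL2 : L2Space := skewPrim oneL2

lemma idL2_ae : (idL2 : ℝ → ℝ) =ᵐ[intervalMeasure] fun x => x := by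
  refine (skewPrim_ae_prim oneL2_ae).trans (Eventually.of_forall fun x => ?_)
  simp only [prim, intervalIntegral.integral_const]
  norm_num

lemma smul_oneL2_ae (c : ℝ) : ((c • oneL2 : L2Space) : ℝ → ℝ) =ᵐ[intervalMeasure] fun _ => c := by
  filter_upwards [Lp.coeFn_smul c oneL2, oneL2_ae] with x h1 h2
  rw [h1, Pi.smul_apply, h2, smul_eq_mul, mul_one]

/-- Only the zero function has a constant `skewPrim`. -/
lemma eq_zero_of_skewPrim_eq_const {f : L2Space} {c : ℝ} (h : skewPrim f = c • oneL2) : f = 0 := by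
  have hc : EqOn (fun x => inner ℝ (signKernel x) f) (fun _ => c) (Icc (-1) 1) := by
    refine eqOn_Icc_of_ae ?_ (continuous_signKernel.inner continuous_const) continuous_const
    exact (skewPrim_ae f).symm.trans (h ▸ smul_oneL2_ae c)
  have hl : inner ℝ (cutoff (-1)) f = 0 := by
    rw [inner_cutoff_eq_intervalIntegral (g := f) (EventuallyEq.refl _ _)
      ⟨le_rfl, by norm_num⟩, intervalIntegral.integral_same]
  have e1 := hc (x := -1) ⟨le_rfl, by norm_num⟩
  have e2 := hc (x := 1) ⟨by norm_num, le_rfl⟩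
  simp only [inner_signKernel, hl] at e1 e2
  change inner ℝ oneL2 f - _ = c at e2
  have h0 : inner ℝ oneL2 f = 0 := by linarith
  have hc0 : c = 0 := by rw [h0] at e1; linarith
  apply eq_zero_of_inner_cutoff
  intro x
  rcases lt_or_ge x (-1) with hx | hx
  · have : Iic x ∩ Icc (-1 : ℝ) 1 = ∅ := by
      ext y
      simp only [mem_inter_iff, mem_Iic, mem_Icc, mem_empty_iff_false, iff_false]
      rintro ⟨h1, h2, -⟩
      linarith
    rw [inner_cutoff, Measure.restrict_restrict measurableSet_Iic, this]
    simp
  rcases le_or_gt x 1 with hx' | hx'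
  · have := hc ⟨hx, hx'⟩
    simp only [inner_signKernel, h0, hc0] at this
    linarith
  · have hs : Iic x ∩ Icc (-1 : ℝ) 1 = Iic 1 ∩ Icc (-1) 1 := by
      ext y
      simp only [mem_inter_iff, mem_Iic, mem_Icc]
      constructor
      · rintro ⟨-, h2, h3⟩
        exact ⟨h3, h2, h3⟩
      · rintro ⟨-, h2, h3⟩
        exact ⟨h3.trans hx'.le, h2, h3⟩
    rw [← h0, oneL2, inner_cutoff, inner_cutoff,
      Measure.restrict_restrict measurableSet_Iic, Measure.restrict_restrict measurableSet_Iic, hs]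

/-! ### The inverse of the boundary value problem -/

/-- The orthogonal projection of `L²[-1, 1]` onto the functions of mean zero. -/
noncomputable def projMeanZero : L2Space →L[ℝ] L2Space := (ℝ ∙ oneL2)ᗮ.starProjection

/-- The orthogonal projection of `L²[-1, 1]` onto the orthogonal complement of the affine
functions. -/
noncomputable def projAffineZero : L2Space →L[ℝ] L2Space :=
  (Submodule.span ℝ {oneL2, idL2})ᗮ.starProjection

lemma projMeanZero_comm (f g : L2Space) :
    inner ℝ (projMeanZero f) g = inner ℝ f (projMeanZero g) :=
  Submodule.inner_starProjection_left_eq_right _ f g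

lemma projAffineZero_comm (f g : L2Space) :
    inner ℝ (projAffineZero f) g = inner ℝ f (projAffineZero g) :=
  Submodule.inner_starProjection_left_eq_right _ f g

lemma inner_oneL2_projMeanZero (f : L2Space) : inner ℝ oneL2 (projMeanZero f) = 0 :=
  Submodule.mem_orthogonal_singleton_iff_inner_right.1 (Submodule.starProjection_apply_mem _ f)

lemma projMeanZero_eq_self {f : L2Space} (h : inner ℝ oneL2 f = 0) : projMeanZero f = f :=
  Submodule.starProjection_eq_self_iff.2 (Submodule.mem_orthogonal_singleton_iff_inner_right.2 h)

lemma exists_sub_projMeanZero (f : L2Space) : ∃ c : ℝ, f = projMeanZero f + c • oneL2 := by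
  have h := Submodule.sub_starProjection_mem_orthogonal (K := (ℝ ∙ oneL2)ᗮ) f
  rw [Submodule.orthogonal_orthogonal, Submodule.mem_span_singleton] at h
  obtain ⟨c, hc⟩ := h
  exact ⟨c, by rw [hc, projMeanZero]; abel⟩

lemma inner_projAffineZero (f : L2Space) :
    inner ℝ oneL2 (projAffineZero f) = 0 ∧ inner ℝ idL2 (projAffineZero f) = 0 := by
  have h := (Submodule.mem_orthogonal _ _).1
    (Submodule.starProjection_apply_mem (Submodule.span ℝ {oneL2, idL2})ᗮ f)
  exact ⟨h _ (Submodule.subset_span (by simp)), h _ (Submodule.subset_span (by simp))⟩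

lemma projAffineZero_idem (f : L2Space) : projAffineZero (projAffineZero f) = projAffineZero f :=
  Submodule.starProjection_eq_self_iff.2 (Submodule.starProjection_apply_mem _ f)

lemma exists_sub_projAffineZero (f : L2Space) :
    ∃ a b : ℝ, f = projAffineZero f + (a • oneL2 + b • idL2) := by
  have hfin : FiniteDimensional ℝ (Submodule.span ℝ {oneL2, idL2}) :=
    FiniteDimensional.span_of_finite ℝ (by simp)
  have h := Submodule.sub_starProjection_mem_orthogonal
    (K := (Submodule.span ℝ {oneL2, idL2})ᗮ) f
  rw [Submodule.orthogonal_orthogonal, Submodule.mem_span_pair] at h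
  obtain ⟨a, b, hab⟩ := h
  exact ⟨a, b, by rw [hab, projAffineZero]; abel⟩

/-- A third-order solution operator, `Q A³ P` with `A = skewPrim`, `P = projMeanZero` and
`Q = projAffineZero`. -/
noncomputable def halfInverse : L2Space →L[ℝ] L2Space :=
  projAffineZero.comp (skewPrim.comp (skewPrim.comp (skewPrim.comp projMeanZero)))

/-- The negative of the adjoint of `halfInverse`. -/
noncomputable def halfInverseAdj : L2Space →L[ℝ] L2Space :=
  projMeanZero.comp (skewPrim.comp (skewPrim.comp (skewPrim.comp projAffineZero)))

/-- The inverse of `f ↦ -f⁽⁶⁾` with the boundary conditions `f' = f'' = f⁽⁵⁾ = 0` at `±1`, on the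
functions of mean zero, extended by `0` to the constants. -/
noncomputable def solutionOp : L2Space →L[ℝ] L2Space := -(halfInverseAdj.comp halfInverse)

lemma inner_halfInverseAdj (f g : L2Space) :
    inner ℝ (halfInverseAdj f) g = -inner ℝ f (halfInverse g) := by
  simp only [halfInverseAdj, halfInverse, ContinuousLinearMap.comp_apply]
  rw [projMeanZero_comm, skewPrim_skew, skewPrim_skew, skewPrim_skew, projAffineZero_comm]
  ring

lemma inner_solutionOp (f g : L2Space) :
    inner ℝ (solutionOp f) g = inner ℝ (halfInverse f) (halfInverse g) := by
  rw [solutionOp, neg_apply, ContinuousLinearMap.comp_apply, inner_neg_left,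
    inner_halfInverseAdj, neg_neg]

lemma isSymmetric_solutionOp : solutionOp.IsSymmetric := by
  intro f g
  change inner ℝ (solutionOp f) g = inner ℝ f (solutionOp g)
  rw [inner_solutionOp, real_inner_comm, ← inner_solutionOp, real_inner_comm]

lemma isCompactOperator_solutionOp : IsCompactOperator solutionOp := by
  have h : IsCompactOperator halfInverse :=
    (isCompactOperator_skewPrim.comp_clm (skewPrim.comp (skewPrim.comp projMeanZero))).clm_comp
      projAffineZero
  exact (h.clm_comp halfInverseAdj).neg

lemma solutionOp_eq_zero {f : L2Space} (h : solutionOp f = 0) : ∃ c : ℝ, f = c • oneL2 := by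
  have hK : halfInverse f = 0 := by
    rw [← inner_self_eq_zero (𝕜 := ℝ), ← inner_solutionOp, h, inner_zero_left]
  obtain ⟨a, b, hab⟩ := exists_sub_projAffineZero (skewPrim (skewPrim (skewPrim (projMeanZero f))))
  change _ = halfInverse f + _ at hab
  rw [hK, zero_add] at hab
  have h1 : skewPrim (skewPrim (skewPrim (projMeanZero f)) - b • oneL2) = a • oneL2 := by
    rw [map_sub, map_smul, hab, idL2]
    abel
  have h2 := sub_eq_zero.1 (eq_zero_of_skewPrim_eq_const h1)
  have h3 := eq_zero_of_skewPrim_eq_const h2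
  have h4 : projMeanZero f = 0 :=
    eq_zero_of_skewPrim_eq_const (c := 0) (by rw [h3, zero_smul])
  obtain ⟨c, hc⟩ := exists_sub_projMeanZero f
  exact ⟨c, by rw [hc, h4, zero_add]⟩

lemma inner_oneL2_solutionOp (f : L2Space) : inner ℝ oneL2 (solutionOp f) = 0 := by
  rw [solutionOp, neg_apply, inner_neg_right, neg_eq_zero]
  exact inner_oneL2_projMeanZero _

/-- An eigenvector of `solutionOp` with eigenvalue `μ ≠ 0` is a classical eigenfunction with
`l⁶ = μ⁻¹`, and hence a combination of the explicit solutions. -/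
lemma eigenvector_solutionOp {f : L2Space} {μ : ℝ} (hμ : μ ≠ 0) (hf : f ≠ 0)
    (h : solutionOp f = μ • f) : ∃ l > 0, ∃ α β : ℝ, (α = 0 ∨ evenRelation l = 0) ∧
      (β = 0 ∨ oddRelation l = 0) ∧ (f : ℝ → ℝ) =ᵐ[intervalMeasure]
        fun x => α * wave l (evenCoeffs l) x + β * wave l (oddCoeffs l) x := by
  have hf1 : inner ℝ oneL2 f = 0 := by
    have := inner_oneL2_solutionOp f
    rw [h, real_inner_smul_right] at this
    exact (mul_eq_zero.1 this).resolve_left hμ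
  have hpos : 0 < μ := by
    have h1 := inner_solutionOp f f
    rw [h, real_inner_smul_left, real_inner_self_eq_norm_sq, real_inner_self_eq_norm_sq] at h1
    have h2 : 0 < ‖f‖ ^ 2 := by positivity
    have h3 : 0 ≤ μ * ‖f‖ ^ 2 := h1 ▸ sq_nonneg _
    exact lt_of_le_of_ne (nonneg_of_mul_nonneg_left h3 h2) hμ.symm
  obtain ⟨l, hl, hl6⟩ : ∃ l : ℝ, 0 < l ∧ l ^ 6 = μ⁻¹ := by
    refine ⟨μ⁻¹ ^ ((6 : ℝ)⁻¹), by positivity, ?_⟩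
    exact_mod_cast Real.rpow_inv_natCast_pow (n := 6) (inv_pos.2 hpos).le (by norm_num)
  -- `g = halfInverse f` is `-f'''/l⁶`, and `f` is recovered from it by three more integrations
  obtain ⟨g, hg⟩ : ∃ g, g = halfInverse f := ⟨_, rfl⟩
  obtain ⟨a, b, hab⟩ := exists_sub_projAffineZero (skewPrim (skewPrim (skewPrim f)))
  obtain ⟨c, hc⟩ := exists_sub_projMeanZero (skewPrim (skewPrim (skewPrim g)))
  have hgA : g = projAffineZero (skewPrim (skewPrim (skewPrim f))) := by
    rw [hg]
    change projAffineZero (skewPrim (skewPrim (skewPrim (projMeanZero f)))) = _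
    rw [projMeanZero_eq_self hf1]
  have hQg : projAffineZero g = g := by rw [hgA, projAffineZero_idem]
  have hg0 : inner ℝ oneL2 g = 0 := hgA ▸ (inner_projAffineZero _).1
  have hg1 : inner ℝ oneL2 (skewPrim g) = 0 := by
    rw [← neg_eq_zero, ← skewPrim_skew]
    exact hgA ▸ (inner_projAffineZero _).2
  have hfg : f = -l ^ 6 • (skewPrim (skewPrim (skewPrim g)) - c • oneL2) := by
    have e : solutionOp f = -projMeanZero (skewPrim (skewPrim (skewPrim g))) := by
      rw [← hQg, hg]
      rfl
    have e2 : projMeanZero (skewPrim (skewPrim (skewPrim g)))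
        = skewPrim (skewPrim (skewPrim g)) - c • oneL2 := eq_sub_of_add_eq hc.symm
    rw [← e2, hl6, neg_smul, ← smul_neg, ← e, h, smul_smul, inv_mul_cancel₀ hμ, one_smul]
  -- a first continuous representative of `f`, and its primitives
  let p : ℝ → ℝ := fun x => -l ^ 6 * (inner ℝ (signKernel x) (skewPrim (skewPrim g)) - c)
  have hp : Continuous p :=
    ((continuous_signKernel.inner continuous_const).sub continuous_const).const_mul _
  have hcomb (F : L2Space) (G : ℝ → ℝ) (hF : F =ᵐ[intervalMeasure] G) :
      ((-l ^ 6 • (F - c • oneL2) : L2Space) : ℝ → ℝ) =ᵐ[intervalMeasure]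
        fun x => -l ^ 6 * (G x - c) := by
    filter_upwards [Lp.coeFn_smul (-l ^ 6) (F - c • oneL2), Lp.coeFn_sub F (c • oneL2),
      smul_oneL2_ae c, hF] with x h1 h2 h3 h4
    rw [h1, Pi.smul_apply, h2, Pi.sub_apply, h3, h4, smul_eq_mul]
  have hfp : f =ᵐ[intervalMeasure] p := by
    have := hcomb _ _ (skewPrim_ae (skewPrim (skewPrim g)))
    rwa [← hfg] at this
  have f1 := skewPrim_ae_prim hfp
  have f2 := skewPrim_ae_prim f1
  have f3 := skewPrim_ae_prim f2
  have c1 := continuous_prim hp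
  have c2 := continuous_prim c1
  have c3 := continuous_prim c2
  let q : ℝ → ℝ := fun x => prim (prim (prim p)) x - (a + b * x)
  have hq : Continuous q := c3.sub (by fun_prop)
  have hgq : g =ᵐ[intervalMeasure] q := by
    have e : g = skewPrim (skewPrim (skewPrim f)) - (a • oneL2 + b • idL2) := by
      rw [hgA]
      exact eq_sub_of_add_eq hab.symm
    rw [e]
    filter_upwards [Lp.coeFn_sub (skewPrim (skewPrim (skewPrim f))) (a • oneL2 + b • idL2),
      Lp.coeFn_add (a • oneL2) (b • idL2), smul_oneL2_ae a, Lp.coeFn_smul b idL2, idL2_ae, f3]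
      with x h1 h2 h3 h4 h5 h6
    rw [h1, Pi.sub_apply, h2, Pi.add_apply, h3, h4, Pi.smul_apply, h5, h6, smul_eq_mul]
  have g1 := skewPrim_ae_prim hgq
  have g2 := skewPrim_ae_prim g1
  have g3 := skewPrim_ae_prim g2
  have k1 := continuous_prim hq
  have k2 := continuous_prim k1
  have k3 := continuous_prim k2
  let u : ℕ → ℝ → ℝ := fun k => match k with
    | 0 => fun x => -l ^ 6 * (prim (prim (prim q)) x - c)
    | 1 => fun x => -l ^ 6 * prim (prim q) x
    | 2 => fun x => -l ^ 6 * prim q x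
    | 3 => fun x => -l ^ 6 * q x
    | 4 => fun x => -l ^ 6 * (prim (prim p) x - b)
    | 5 => fun x => -l ^ 6 * prim p x
    | _ => fun x => -l ^ 6 * p x
  have hfu : f =ᵐ[intervalMeasure] u 0 := by
    have := hcomb _ _ g3
    rwa [← hfg] at this
  have hpu : EqOn p (u 0) (Icc (-1) 1) :=
    eqOn_Icc_of_ae (hfp.symm.trans hfu) hp ((k3.sub continuous_const).const_mul _)
  have hu : ∀ k < 6, ∀ x, HasDerivAt (u k) (u (k + 1) x) x := by
    intro k hk x
    interval_cases k
    · exact ((hasDerivAt_prim k2 x).sub_const c).const_mul _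
    · exact (hasDerivAt_prim k1 x).const_mul _
    · exact (hasDerivAt_prim hq x).const_mul _
    · refine HasDerivAt.const_mul _ ((hasDerivAt_prim c2 x).sub ?_)
      simpa using ((hasDerivAt_id x).const_mul b).const_add a
    · exact ((hasDerivAt_prim c1 x).sub_const b).const_mul _
    · exact (hasDerivAt_prim hp x).const_mul _
  have b1 : u 1 (-1) = 0 ∧ u 1 1 = 0 := by
    have := prim_endpoints g1 hg1
    simp [u, this]
  have b2 : u 2 (-1) = 0 ∧ u 2 1 = 0 := by
    have := prim_endpoints hgq hg0
    simp [u, this]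
  have b5 : u 5 (-1) = 0 ∧ u 5 1 = 0 := by
    have := prim_endpoints hfp hf1
    simp [u, this]
  have h6 : ∀ x ∈ Icc (-1 : ℝ) 1, u 6 x = -l ^ 6 * u 0 x := by
    intro x hx
    rw [← hpu hx]
    rfl
  obtain ⟨α, β, hα, hβ, hw⟩ := exists_eq_even_add_odd hl.ne' hu h6 b1 b2 b5
  refine ⟨l, hl, α, β, hα, hβ, ?_⟩
  filter_upwards [hfu, ae_restrict_mem measurableSet_Icc] with x hx hx1
  rw [hx, hw x hx1]

/-! ### Completeness and the eigenfunction expansion -/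

lemma memLp_of_continuous {f : ℝ → ℝ} (hf : Continuous f) : MemLp f 2 intervalMeasure := by
  obtain ⟨C, hC⟩ :=
    isCompact_Icc.exists_bound_of_continuousOn (s := Icc (-1 : ℝ) 1) hf.continuousOn
  refine MemLp.of_bound hf.aestronglyMeasurable C ?_
  filter_upwards [ae_restrict_mem measurableSet_Icc] with x hx using hC x hx

lemma inner_eq_pairing {F G : L2Space} {f g : ℝ → ℝ} (hf : F =ᵐ[intervalMeasure] f)
    (hg : G =ᵐ[intervalMeasure] g) : inner ℝ F G = pairing f g := by
  rw [inner_eq_integral, pairing, ← integral_intervalMeasure]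
  refine integral_congr_ae ?_
  filter_upwards [hf, hg] with x h1 h2
  rw [h1, h2]

/-- The modes form a Hilbert basis: a function orthogonal to all of them is orthogonal to every
eigenvector of the compact symmetric operator `solutionOp`, so it vanishes. -/
lemma exists_hilbertBasis_mode {lc ls : ℕ+ → ℝ} (hlc : EnumeratesPositiveRoots evenRelation lc)
    (hls : EnumeratesPositiveRoots oddRelation ls) :
    ∃ b : HilbertBasis Mode ℝ L2Space, ∀ i, (b i : ℝ → ℝ) =ᵐ[intervalMeasure] mode lc ls i := by
  classical
  have hc (m) : 0 < lc m ∧ evenRelation (lc m) = 0 := by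
    have : lc m ∈ range lc := mem_range_self m
    rwa [hlc.2] at this
  have hs (m) : 0 < ls m ∧ oddRelation (ls m) = 0 := by
    have : ls m ∈ range ls := mem_range_self m
    rwa [hls.2] at this
  have hmem (i) : MemLp (mode lc ls i) 2 intervalMeasure :=
    memLp_of_continuous (continuous_mode (fun m => (hc m).1) (fun m => (hs m).1) i)
  let e : Mode → L2Space := fun i => (hmem i).toLp
  have he (i) : (e i : ℝ → ℝ) =ᵐ[intervalMeasure] mode lc ls i := (hmem i).coeFn_toLp
  have horth : Orthonormal ℝ e := by
    rw [orthonormal_iff_ite]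
    intro i j
    rw [inner_eq_pairing (he i) (he j)]
    have h := pairing_mode hlc.1.injective hls.1.injective hc hs i j
    split_ifs with hij
    · exact h.1 hij
    · exact h.2 hij
  have hconst : oneL2 ∈ Submodule.span ℝ (range e) := by
    have : oneL2 = √2 • e Mode.const := by
      refine Lp.ext ?_
      filter_upwards [oneL2_ae, Lp.coeFn_smul (√2) (e Mode.const), he Mode.const] with x h1 h2 h3
      rw [h1, h2, Pi.smul_apply, h3]
      simp [mode, psiZero]
    rw [this]
    exact Submodule.smul_mem _ _ (Submodule.subset_span (mem_range_self _))
  have hspan (c l : ℝ) (a : Coeffs) (i : Mode) {N : ℝ} (hN : N ≠ 0)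
      (hi : ∀ x, mode lc ls i x = N * wave l a x) :
      ∃ v ∈ Submodule.span ℝ (range e), (v : ℝ → ℝ) =ᵐ[intervalMeasure]
        fun x => c * wave l a x := by
    refine ⟨(c / N) • e i, Submodule.smul_mem _ _ (Submodule.subset_span (mem_range_self _)), ?_⟩
    filter_upwards [Lp.coeFn_smul (c / N) (e i), he i] with x h1 h2
    rw [h1, Pi.smul_apply, h2, hi, smul_eq_mul]
    field_simp
  have hzero (l : ℝ) (a : Coeffs) : ∃ v ∈ Submodule.span ℝ (range e),
      (v : ℝ → ℝ) =ᵐ[intervalMeasure] fun x => 0 * wave l a x := by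
    refine ⟨0, Submodule.zero_mem _, ?_⟩
    filter_upwards [Lp.coeFn_zero ℝ 2 intervalMeasure] with x hx
    rw [hx, zero_mul]
    rfl
  have heigen (μ : ℝ) (f : L2Space) (hf : solutionOp f = μ • f) :
      f ∈ Submodule.span ℝ (range e) := by
    rcases eq_or_ne f 0 with rfl | hf0
    · exact Submodule.zero_mem _
    rcases eq_or_ne μ 0 with rfl | hμ
    · obtain ⟨c, rfl⟩ := solutionOp_eq_zero (by rw [hf, zero_smul])
      exact Submodule.smul_mem _ _ hconst
    obtain ⟨l, hl, α, β, hα, hβ, hw⟩ := eigenvector_solutionOp hμ hf0 hf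
    obtain ⟨v, hv, hv'⟩ : ∃ v ∈ Submodule.span ℝ (range e), (v : ℝ → ℝ) =ᵐ[intervalMeasure]
        fun x => α * wave l (evenCoeffs l) x := by
      rcases hα with rfl | hα
      · exact hzero _ _
      have : l ∈ range lc := by rw [hlc.2]; exact ⟨hl, hα⟩
      obtain ⟨m, rfl⟩ := this
      have hd := evenD_pos hl hα
      exact hspan α _ _ (Mode.even m) (N := 2 * √(lc m / evenD (lc m))) (by positivity)
        (evenPsi_eq hl.ne')
    obtain ⟨w, hw1, hw2⟩ : ∃ v ∈ Submodule.span ℝ (range e), (v : ℝ → ℝ) =ᵐ[intervalMeasure]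
        fun x => β * wave l (oddCoeffs l) x := by
      rcases hβ with rfl | hβ
      · exact hzero _ _
      have : l ∈ range ls := by rw [hls.2]; exact ⟨hl, hβ⟩
      obtain ⟨m, rfl⟩ := this
      have hd := oddD_pos hl hβ
      exact hspan β _ _ (Mode.odd m) (N := 2 * √(ls m / oddD (ls m))) (by positivity)
        (oddPsi_eq hl.ne')
    have : f = v + w := by
      refine Lp.ext ?_
      filter_upwards [hw, Lp.coeFn_add v w, hv', hw2] with x h1 h2 h3 h4
      rw [h1, h2, Pi.add_apply, h3, h4]
    rw [this]
    exact Submodule.add_mem _ hv hw1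
  have hbot : (Submodule.span ℝ (range e))ᗮ = ⊥ := by
    rw [eq_bot_iff, ← ContinuousLinearMap.orthogonalComplement_iSup_eigenspaces_eq_bot
      isCompactOperator_solutionOp isSymmetric_solutionOp]
    refine Submodule.orthogonal_le (iSup_le fun μ f hf => ?_)
    exact heigen μ f (Module.End.mem_eigenspace_iff.1 hf)
  refine ⟨HilbertBasis.mkOfOrthogonalEqBot horth hbot, fun i => ?_⟩
  rw [HilbertBasis.coe_mkOfOrthogonalEqBot]
  exact he i

/-- The modes that enter the `M`-th partial sum. -/
def modesUpTo (M : ℕ+) : Finset Mode :=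
  Finset.cons Mode.const
    (((Finset.Icc 1 M).map ⟨Mode.even, fun _ _ h => Mode.even.inj h⟩).disjUnion
      ((Finset.Icc 1 M).map ⟨Mode.odd, fun _ _ h => Mode.odd.inj h⟩) (by
        rw [Finset.disjoint_left]
        intro i hi hj
        simp only [Finset.mem_map] at hi hj
        obtain ⟨m, -, rfl⟩ := hi
        obtain ⟨n, -, hn⟩ := hj
        exact Mode.noConfusion hn))
    (by simp)

lemma tendsto_modesUpTo : Tendsto modesUpTo atTop atTop := by
  refine tendsto_atTop_finset_of_monotone (fun M N h => ?_) fun i => ?_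
  · intro i hi
    simp only [modesUpTo, Finset.mem_cons, Finset.mem_disjUnion, Finset.mem_map,
      Finset.mem_Icc] at hi ⊢
    rcases hi with hi | ⟨m, hm, hi⟩ | ⟨m, hm, hi⟩
    · exact Or.inl hi
    · exact Or.inr (Or.inl ⟨m, ⟨hm.1, hm.2.trans h⟩, hi⟩)
    · exact Or.inr (Or.inr ⟨m, ⟨hm.1, hm.2.trans h⟩, hi⟩)
  · cases i with
    | const => exact ⟨1, by simp [modesUpTo]⟩
    | even m =>
      refine ⟨m, ?_⟩
      simp only [modesUpTo, Finset.mem_cons, Finset.mem_disjUnion, Finset.mem_map, Finset.mem_Icc]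
      exact Or.inr (Or.inl ⟨m, ⟨one_le, le_rfl⟩, rfl⟩)
    | odd m =>
      refine ⟨m, ?_⟩
      simp only [modesUpTo, Finset.mem_cons, Finset.mem_disjUnion, Finset.mem_map, Finset.mem_Icc]
      exact Or.inr (Or.inr ⟨m, ⟨one_le, le_rfl⟩, rfl⟩)

lemma partialExpansion_eq_sum (lc ls : ℕ+ → ℝ) (u : ℝ → ℝ) (M : ℕ+) (x : ℝ) :
    partialExpansion lc ls u M x
      = ∑ i ∈ modesUpTo M, pairing u (mode lc ls i) * mode lc ls i x := by
  have h : pairing u (fun x => psiZero x / √2) = (√2)⁻¹ * pairing u psiZero := by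
    simp only [pairing, psiZero]
    rw [← intervalIntegral.integral_const_mul]
    congr 1
    ext x
    ring
  have h2 : (√2 : ℝ)⁻¹ * (√2)⁻¹ = 1 / 2 := by
    rw [← mul_inv, Real.mul_self_sqrt (by norm_num)]
    norm_num
  rw [modesUpTo, Finset.sum_cons, Finset.sum_disjUnion, Finset.sum_map, Finset.sum_map,
    partialExpansion, Finset.sum_add_distrib]
  simp only [mode, h]
  congr 1
  linear_combination -(pairing u psiZero * psiZero x) * h2

lemma tendsto_eLpNorm_sub_partialExpansion {lc ls : ℕ+ → ℝ} {b : HilbertBasis Mode ℝ L2Space}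
    (hb : ∀ i, (b i : ℝ → ℝ) =ᵐ[intervalMeasure] mode lc ls i) {u : ℝ → ℝ}
    (hu : MemLp u 2 intervalMeasure) :
    Tendsto (fun M : ℕ+ => eLpNorm (fun x => u x - partialExpansion lc ls u M x) 2 intervalMeasure)
      atTop (𝓝 0) := by
  have hU := hu.coeFn_toLp
  have hsum := (b.hasSum_repr hu.toLp).comp tendsto_modesUpTo
  have hlim := tendsto_iff_edist_tendsto_0.1 hsum
  refine hlim.congr fun M => ?_
  rw [edist_comm, Lp.edist_def]
  refine eLpNorm_congr_ae ?_
  have hcoef (i) : b.repr hu.toLp i = pairing u (mode lc ls i) := by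
    rw [b.repr_apply_apply, inner_eq_pairing (hb i) hU, pairing_comm]
  have hfin (s : Finset Mode) : ((∑ i ∈ s, b.repr hu.toLp i • b i : L2Space) : ℝ → ℝ)
      =ᵐ[intervalMeasure] fun x => ∑ i ∈ s, pairing u (mode lc ls i) * mode lc ls i x := by
    classical
    induction s using Finset.induction_on with
    | empty =>
      simp only [Finset.sum_empty]
      exact Lp.coeFn_zero _ _ _
    | insert i s his ih =>
      simp only [Finset.sum_insert his]
      filter_upwards [Lp.coeFn_add (b.repr hu.toLp i • b i) (∑ i ∈ s, b.repr hu.toLp i • b i), ih,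
        Lp.coeFn_smul (b.repr hu.toLp i) (b i), hb i] with x h1 h2 h3 h4
      rw [h1, Pi.add_apply, h2, h3, Pi.smul_apply, h4, hcoef, smul_eq_mul]
  filter_upwards [hU, hfin (modesUpTo M)] with x h1 h2
  rw [partialExpansion_eq_sum, ← h2, ← h1]
  rfl

end SixthOrderBeam

theorem proposition3 :
    ∃ lc ls : ℕ+ → ℝ,
      -- the positive roots of the two eigenvalue relations, in increasing order
      EnumeratesPositiveRoots evenRelation lc ∧
      EnumeratesPositiveRoots oddRelation ls ∧
      -- the explicit functions are even, resp. odd, eigenfunctions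
      IsEigenfunction 0 psiZero ∧
      (∀ m : ℕ+, IsEigenfunction (lc m) (evenPsi (lc m)) ∧ Function.Even (evenPsi (lc m))) ∧
      (∀ m : ℕ+, IsEigenfunction (ls m) (oddPsi (ls m)) ∧ Function.Odd (oddPsi (ls m))) ∧
      -- together they form a complete orthonormal set in L²[-1, 1]
      (∃ b : HilbertBasis Mode ℝ (Lp ℝ 2 intervalMeasure),
        ∀ i : Mode, (b i : ℝ → ℝ) =ᵐ[intervalMeasure] mode lc ls i) ∧
      -- every u in L²[-1, 1] is the L² limit of its eigenfunction expansion
      (∀ u : ℝ → ℝ, MemLp u 2 intervalMeasure →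
        Tendsto
          (fun M : ℕ+ => eLpNorm (fun x => u x - partialExpansion lc ls u M x) 2 intervalMeasure)
          atTop (𝓝 0)) := by
  obtain ⟨lc, hlc⟩ := exists_enumeratesPositiveRoots_even
  obtain ⟨ls, hls⟩ := exists_enumeratesPositiveRoots_odd
  have hc (m) : 0 < lc m ∧ evenRelation (lc m) = 0 := by
    have : lc m ∈ range lc := mem_range_self m
    rwa [hlc.2] at this
  have hs (m) : 0 < ls m ∧ oddRelation (ls m) = 0 := by
    have : ls m ∈ range ls := mem_range_self m
    rwa [hls.2] at this
  obtain ⟨b, hb⟩ := exists_hilbertBasis_mode hlc hls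
  exact ⟨lc, ls, hlc, hls, isEigenfunction_psiZero,
    fun m => ⟨isEigenfunction_evenPsi (hc m).1 (hc m).2, even_evenPsi _⟩,
    fun m => ⟨isEigenfunction_oddPsi (hs m).1 (hs m).2, odd_oddPsi _⟩,
    ⟨b, hb⟩, fun u hu => tendsto_eLpNorm_sub_partialExpansion hb hu⟩
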